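/- Let $G$ be a weighted ring graph on $n\ge 3$ nodes $V$, numbered clockwise, with edge weights $W_{ij}=W_{ji}>0$, and let $L$ be its weighted Laplacian: $L_{ij}=-W_{ij}$ if $\{i,j\}$ is an edge, $L_{ii}=\sum_{j\sim i}W_{ij}$, and $L_{ij}=0$ otherwise. For a set $S\subseteq V$ of leaders let $L_{ff}$ be the principal submatrix of $L$ on the rows and columns of the followers $V\setminus S$, and let $C(S)=\lambda_{\min}(L_{ff})$ be its smallest eigenvalue (the smallest eigenvalue of a matrix of order $0$ is $+\infty$). For $u,v\in V$ let $L_{(u\to v)}$ be the principal submatrix of $L$ on the nodes strictly between $u$ and $v$ in clockwise order from $u$ to $v$ (on all nodes other than $u$ if $u=v$). Let $1\le k\le n$. The $k$-leader selection algorithm for fast convergence is the following. It computes $L$ and all weights $\lambda_{\min}(L_{(u\to v)})$. For each initial leader $i\in V$ it builds the digraph $\overline G_i$ with vertex set $\{s_i,t_i\}\cup(V\setminus\{i\})$ and with the edges $(s_i,v)$, $(u,v)$, $(v,t_i)$ for all $u\ne v$ in $V\setminus\{i\}$ and the edge $(s_i,t_i)$, where the edge from $x$ to $y$ has weight $\lambda_{\min}(L_{(x\to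 y)})$, with $s_i$ and $t_i$ read as $i$. By a Bellman–Ford iteration $$d_0(s_i)=\infty,\qquad d_0(v)=-\infty\ (v\ne s_i),\qquad d_m(v)=\max_{u\in N(v)}\min\{d_{m-1}(u),w(u,v)\}\quad(1\le m\le k)$$ ($N(v)$ the set of in-neighbours of $v$ in $\overline G_i$; a maximum over the empty set is $-\infty$), with predecessors $\pi_m(v)\in\arg\max_{u\in N(v)}\min\{d_{m-1}(u),w(u,v)\}$, it finds a path of at most $k$ edges from $s_i$ to $t_i$ for which the minimal edge weight is as large as possible: it starts with $l=k$, decreases $l$ by one as long as $d_l(t_i)=d_{l-1}(t_i)$, and then follows the predecessors $\pi_l,\pi_{l-1},\dots$ back from $t_i$; the value of the path is $d_l(t_i)$. Among the $n$ paths it keeps one of largest value. Ties are broken in favour of the candidate that is examined first, in a fixed order of the vertices. It returns the set $S$ that consists of the initial leader $i$ of that path and of the vertices of the path other than $s_i,t_i$, together with the value of the path. Theorem. The returned set $S$ satisfies $|S|\le k$ and maximizes $C$ over all $S'\subseteq V$ with $|S'|\le k$, and the returned value is $C(S)$. The algorithm uses $O(kn^3)$ operations. Here an arithmetic operation or comparison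 of extended real numbers or indices and an access to memory each count as one operation, and the computation of the smallest eigenvalue of a symmetric tridiagonal matrix of order $m$ counts as $c\,(m+1)$ operations for a fixed constant $c$; the constant in $O(kn^3)$ depends only on $c$. -/

import Mathlib

noncomputable section

namespace RingLeader

/-! ## The optimization problem -/

/-- The smallest eigenvalue of a real square matrix, as an extended real number.  For a symmetric
matrix of positive order the infimum is attained; for the matrix of order `0` the value is `⊤`. -/
def minEigenvalue {ι : Type} [Fintype ι] [DecidableEq ι] (A : Matrix ι ι ℝ) : EReal :=
  ⨅ μ ∈ {μ : ℝ | Module.End.HasEigenvalue (Matrix.toLin' A) μ}, (μ : EReal)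

/-- The weighted Laplacian of the graph `G` with edge weights `W`. -/
def weightedLaplacian {V : Type} [Fintype V] [DecidableEq V] (G : SimpleGraph V)
    [DecidableRel G.Adj] (W : V → V → ℝ) : Matrix V V ℝ :=
  Matrix.of fun i j =>
    if i = j then ∑ l ∈ G.neighborFinset i, W i l else if G.Adj i j then - W i j else 0

/-- The block of `L` whose rows and columns are those of the followers, that is, of the nodes
outside the leader set `S`. -/
def followerBlock {V : Type} [DecidableEq V] (L : Matrix V V ℝ) (S : Finset V) :
    Matrix {v : V // v ∉ S} {v : V // v ∉ S} ℝ :=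
  L.submatrix (fun v => v.1) (fun v => v.1)

/-- The convergence rate of the weighted ring on `n` nodes with leader set `S`. -/
def convergenceRate {n : ℕ} (W : Fin n → Fin n → ℝ) (S : Finset (Fin n)) : EReal :=
  minEigenvalue (followerBlock (weightedLaplacian (SimpleGraph.cycleGraph n) W) S)

/-! ## Computations with an operation count -/

/-- A computation: its result, and the number of elementary operations that it executes. -/
structure Counted (α : Type) where
  /-- the result -/
  val : α
  /-- the number of elementary operations -/
  ops : ℕ

instance : Monad Counted where
  pure a := ⟨a, 0⟩
  bind x f := ⟨(f x.val).val, x.ops + (f x.val).ops⟩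

/-- One elementary operation: one arithmetic operation or one comparison of scalars or of indices,
or one prepending of an element to a list. -/
def op {α : Type} (a : α) : Counted α := ⟨a, 1⟩

/-- Random access memory: a two-dimensional table. -/
abbrev Table (ι κ α : Type) := ι → κ → α

/-- Reading one table entry is one operation. -/
def read {ι κ α : Type} (T : Table ι κ α) (i : ι) (j : κ) : Counted α := ⟨T i j, 1⟩

/-- Writing one table entry is one operation. -/
def write {ι κ α : Type} [DecidableEq ι] [DecidableEq κ] (T : Table ι κ α) (i : ι) (j : κ) (x : α) :
    Counted (Table ι κ α) :=
  ⟨Function.update T i (Function.update (T i) j x), 1⟩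

/-- A `for` loop over a list, with loop state in `σ`; each iteration costs one operation in
addition to those of the body. -/
def forEach {ι σ : Type} : List ι → (ι → σ → Counted σ) → σ → Counted σ
  | [], _, st => pure st
  | i :: is, body, st => do
      let i ← op i
      let st ← body i st
      forEach is body st

/-- The symmetric tridiagonal matrix of order `m` with diagonal `a 0, …, a (m - 1)` and
off-diagonal `b 0, …, b (m - 2)`. -/
def tridiagonal (m : ℕ) (a b : ℕ → ℝ) : Matrix (Fin m) (Fin m) ℝ :=
  Matrix.of fun i j =>
    if i = j then a i
    else if (i : ℕ) + 1 = j then b i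
    else if (j : ℕ) + 1 = i then b j
    else 0

/-- The eigenvalue routine of the machine: the smallest eigenvalue of a symmetric tridiagonal
matrix of order `m`, charged with `c * (m + 1)` operations.  (Eigenvalues are not obtainable by
finitely many arithmetic operations, so that this has to be a basic routine of the model.) -/
def tridiagonalMinEigenvalue (c m : ℕ) (a b : ℕ → ℝ) : Counted EReal :=
  ⟨minEigenvalue (tridiagonal m a b), c * (m + 1)⟩

/-! ## Edge weights -/

/-- The clockwise neighbour of a node of the ring. -/
def next {n : ℕ} (p : Fin n) : Fin n := ⟨(p + 1) % n, Nat.mod_lt _ p.pos⟩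

/-- The counterclockwise neighbour of a node of the ring. -/
def prev {n : ℕ} (p : Fin n) : Fin n := ⟨(p + (n - 1)) % n, Nat.mod_lt _ p.pos⟩

/-- Computes the Laplacian of the weighted ring. -/
def computeLaplacian {n : ℕ} (W : Fin n → Fin n → ℝ) : Counted (Table (Fin n) (Fin n) ℝ) :=
  forEach (List.finRange n) (fun i L => do
    let L ← forEach (List.finRange n) (fun j L => write L i j 0) L
    let p ← op (prev i)
    let q ← op (next i)
    let x ← read W i p
    let y ← read W i q
    let x' ← op (-x)
    let y' ← op (-y)
    let z ← op (x + y)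
    let L ← write L i p x'
    let L ← write L i q y'
    write L i i z) (fun _ _ => 0)

/-- Computes the smallest eigenvalue of the submatrix of `L` that belongs to the segment of the
nodes strictly between `u` and `v`, in clockwise order from `u` to `v`.  The rows and columns of
the segment are first copied, in this order, to a tridiagonal matrix. -/
def segmentWeight {n : ℕ} (c : ℕ) (L : Table (Fin n) (Fin n) ℝ) (u v : Fin n) : Counted EReal := do
  let m₁ ← op ((v : ℕ) + (n - 1))
  let m₂ ← op (m₁ - (u : ℕ))
  let m ← op (m₂ % n)
  let p ← op (next u)
  let st ← forEach (List.range m) (fun j (st : Fin n × Table ℕ Bool ℝ) => do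
    let q ← op (next st.1)
    let x ← read L st.1 st.1
    let y ← read L st.1 q
    let T ← write st.2 j false x
    let T ← write T j true y
    pure (q, T)) (p, fun _ _ => 0)
  -- `m` is the number of nodes strictly between `u` and `v`; it is `n - 1` if `u = v`
  tridiagonalMinEigenvalue c m (fun j => st.2 j false) (fun j => st.2 j true)

/-- Computes the table of the weights of all segments. -/
def segmentWeights {n : ℕ} (c : ℕ) (L : Table (Fin n) (Fin n) ℝ) :
    Counted (Table (Fin n) (Fin n) EReal) :=
  forEach (List.finRange n) (fun u R =>
    forEach (List.finRange n) (fun v R => do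
      let x ← segmentWeight c L u v
      write R u v x) R) (fun _ _ => 0)

/-! ## Widest paths with a bounded number of edges -/

/-- A weighted digraph as a data structure: the list of its vertices, and for every pair of
vertices `u`, `v` the weight of the edge from `u` to `v`, or `none` if there is no such edge. -/
structure WeightedDigraph (V : Type) where
  /-- the list of the vertices -/
  verts : List V
  /-- the table of the weights -/
  weight : Table V V (Option EReal)

/-- One update of the Bellman–Ford algorithm at the vertex `v`: from the row `d m` of widths, the
maximum over the in-neighbours `u` of `v` of `min (d m u) (weight u v)`, and a `u` that attains
it. -/
def relax {V : Type} (G : WeightedDigraph V) (d : Table ℕ V EReal) (m : ℕ) (v : V) :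
    Counted (EReal × Option V) :=
  forEach G.verts (fun u st => do
    let e ← read G.weight u v
    match e with
    | none => pure st
    | some y => do
      let x ← read d m u
      let z ← op (min x y)
      let better ← op (decide (st.1 < z))
      if better then pure (z, some u) else pure st) (⊥, none)

/-- The search for the last length, at most the given one, at which the width changes. -/
def shortestLength {V : Type} (d : Table ℕ V EReal) (t : V) : ℕ → Counted ℕ
  | 0 => pure 0
  | l + 1 => do
      let x ← read d (l + 1) t
      let y ← read d l t
      let same ← op (decide (x = y))
      if same then
        let _ ← op l
        shortestLength d t l
      else pure (l + 1)

/-- The path of `l` edges that ends in `v`, last vertex first, from the table of predecessors. -/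
def tracePath {V : Type} (pred : Table ℕ V (Option V)) : ℕ → V → Counted (List V)
  | 0, v => op [v]
  | l + 1, v => do
      let u? ← read pred (l + 1) v
      match u? with
      | none => op [v]
      | some u => do
        let P ← tracePath pred l u
        op (v :: P)

/-- The Bellman–Ford algorithm for a widest path from `s` to `t` of at most `H` edges; it returns
the list of the vertices of the path and its width.  The entry `d m v` is the width of a widest
path from `s` to `v` of exactly `m` edges, `⊥` if there is none, and `pred m v` is the predecessor
of `v` on such a path. -/
def widestPath {V : Type} [DecidableEq V] (G : WeightedDigraph V) (s t : V) (H : ℕ) :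
    Counted (List V × EReal) := do
  let d ← forEach (List.range (H + 1)) (fun m d =>
    forEach G.verts (fun v d => write d m v ⊥) d) (fun _ _ => 0)
  let d ← write d 0 s ⊤
  let pred ← forEach (List.range (H + 1)) (fun m pred =>
    forEach G.verts (fun v pred => write pred m v none) pred) (fun _ _ => none)
  let st ← forEach (List.range H) (fun m (st : Table ℕ V EReal × Table ℕ V (Option V)) =>
    forEach G.verts (fun v (st : Table ℕ V EReal × Table ℕ V (Option V)) => do
      let best ← relax G st.1 m v
      let d ← write st.1 (m + 1) v best.1
      let pred ← write st.2 (m + 1) v best.2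
      pure (d, pred)) st) (d, pred)
  let l ← shortestLength st.1 t H
  let P ← tracePath st.2 l t
  let w ← read st.1 l t
  pure (P, w)

/-! ## The leader selection algorithm -/

/-- The vertices of the digraph for an initial leader. -/
inductive Vertex (n : ℕ) where
  | source : Vertex n
  | target : Vertex n
  | node (v : Fin n) : Vertex n
  deriving DecidableEq

/-- The weight of an edge of the digraph for the initial leader `i`, looked up in the table `R` of
segment weights; `none` if there is no edge.  The source and the target both stand for `i`. -/
def edgeWeight {n : ℕ} (R : Table (Fin n) (Fin n) EReal) (i : Fin n) :
    Vertex n → Vertex n → Counted (Option EReal)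
  | .source, .node v => do
      let x ← read R i v
      pure (some x)
  | .source, .target => do
      let x ← read R i i
      pure (some x)
  | .node u, .node v => do
      let same ← op (decide (u = v))
      if same then pure none
      else
        let x ← read R u v
        pure (some x)
  | .node u, .target => do
      let x ← read R u i
      pure (some x)
  | .source, .source => op none
  | .node _, .source => op none
  | .target, _ => op none

/-- Constructs the digraph for the initial leader `i`: its vertices are the source, the target and
all nodes of the ring other than `i`. -/
def buildDigraph {n : ℕ} (R : Table (Fin n) (Fin n) EReal) (i : Fin n) :
    Counted (WeightedDigraph (Vertex n)) := do
  let nodes ← forEach (List.finRange n) (fun v (l : List (Vertex n)) => do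
    let same ← op (decide (v = i))
    if same then pure l else op (Vertex.node v :: l)) []
  let nodes ← op (Vertex.target :: nodes)
  let verts ← op (Vertex.source :: nodes)
  let weight ← forEach verts (fun x T =>
    forEach verts (fun y T => do
      let e ← edgeWeight R i x y
      write T x y e) T) (fun _ _ => none)
  pure ⟨verts, weight⟩

/-- Constructs the leader set from the initial leader `i` and the vertices of a path: the source
and the target are dropped, and `i` is added.  A set of nodes is kept as a bit vector, so that the
creation of the empty set costs `n` operations and an insertion one. -/
def leaderSet {n : ℕ} (i : Fin n) (P : List (Vertex n)) : Counted (Finset (Fin n)) := do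
  let S ← (⟨∅, n⟩ : Counted (Finset (Fin n)))
  let S ← op (insert i S)
  forEach P (fun x S =>
    match x with
    | .source => pure S
    | .target => pure S
    | .node v => op (insert v S)) S

/-- The `k`-leader selection algorithm for fast convergence in the ring on `n` nodes with edge
weights `W`; it returns a leader set and its convergence rate. -/
def selectLeaders {n : ℕ} (c : ℕ) (W : Fin n → Fin n → ℝ) (k : ℕ) :
    Counted (Finset (Fin n) × EReal) := do
  let L ← computeLaplacian W
  let R ← segmentWeights c L
  let best ← forEach (List.finRange n)
    (fun i (best : Option (Fin n × List (Vertex n)) × EReal) => do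
      let G ← buildDigraph R i
      let Pw ← widestPath G Vertex.source Vertex.target k
      let better ← op (decide (best.2 < Pw.2))
      if better then pure (some (i, Pw.1), Pw.2) else pure best) (none, ⊥)
  match best.1 with
  | none => pure (∅, best.2)
  | some iP => do
    let S ← leaderSet iP.1 iP.2
    pure (S, best.2)

end RingLeader

end

namespace RingLeader

open Matrix

/-! ## Smallest eigenvalues and quadratic forms -/

/-! The smallest eigenvalue of the principal block of `L` on a node set `T` is at least a real `r`
exactly when the quadratic form of `L` dominates `r * (x ⬝ᵥ x)` on the vectors supported in `T`. All
eigenvalue comparisons go through such thresholds (`FormBoundedBelowOn`): shrinking `T` can only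
raise the eigenvalue, and an empty block needs no separate treatment.

The width found for `i` is at least the rate of every admissible leader set containing `i`
(`convergenceRate_le_width`). Such a set may be enlarged to exactly `k` leaders. Listed clockwise
from `i`, these form a walk of exactly `k` edges from source to target. No leader lies inside any of
its segments, so each segment consists of followers and each edge weight is at least the rate.

Conversely, the traced walk may repeat nodes and wind around the ring several times. Still, a closed
walk passes every node it does not visit (`exists_strictlyBetween`), and adjacent followers lie in
the same segments (`strictlyBetween_iff_of_adj`). Hence the follower block splits into uncoupled
pieces, each contained in a segment, and the rate is at least the width (`FormBoundedBelowOn.glue`,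
`le_convergenceRate_of_walk`). The traced set is itself admissible, so both bounds apply to it and
width equals rate (`widestPath_spec`). Maximizing over `i` yields the optimum.

The cost is dominated by the eigenvalues of `n ^ 2` segments of fewer than `n` nodes and by `n`
Bellman–Ford runs, each with `k` rounds over at most `(n + 2) ^ 2` pairs of vertices. -/

theorem le_of_forall_real_le {a b : EReal} (h : ∀ r : ℝ, (r : EReal) ≤ a → (r : EReal) ≤ b) :
    a ≤ b :=
  EReal.ge_of_forall_gt_iff_ge.1 fun r hr => h r hr.le

/-- Both sides say that `A - r • 1` is positive semidefinite, one through its eigenvalues and the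
other through its form. In order `0` both hold for every `r`, in accordance with the value `⊤`. -/
theorem le_minEigenvalue_iff {ι : Type} [Fintype ι] [DecidableEq ι] {A : Matrix ι ι ℝ}
    (hA : A.IsHermitian) (r : ℝ) :
    (r : EReal) ≤ minEigenvalue A ↔ ∀ x : ι → ℝ, r * (x ⬝ᵥ x) ≤ x ⬝ᵥ A *ᵥ x := by
  have hB : (A - r • (1 : Matrix ι ι ℝ)).IsHermitian :=
    hA.sub (by simp [Matrix.IsHermitian])
  have hform (x : ι → ℝ) :
      x ⬝ᵥ (A - r • (1 : Matrix ι ι ℝ)) *ᵥ x = x ⬝ᵥ A *ᵥ x - r * (x ⬝ᵥ x) := by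
    simp [Matrix.sub_mulVec, dotProduct_sub, Matrix.smul_mulVec, dotProduct_smul]
  simp only [minEigenvalue, le_iInf₂_iff, EReal.coe_le_coe_iff, Set.mem_ofPred_eq]
  constructor
  · intro h x
    have hpos : (A - r • (1 : Matrix ι ι ℝ)).PosSemidef := by
      rw [hB.posSemidef_iff_eigenvalues_nonneg]
      intro j
      have hj := hB.mulVec_eigenvectorBasis j
      have hne : (⇑(hB.eigenvectorBasis j) : ι → ℝ) ≠ 0 := by
        intro h0
        apply hB.eigenvectorBasis.orthonormal.ne_zero j
        ext i
        exact congrFun h0 i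
      have := h (hB.eigenvalues j + r) (Module.End.hasEigenvalue_of_hasEigenvector
        (x := (⇑(hB.eigenvectorBasis j) : ι → ℝ)) (Module.End.hasEigenvector_iff.2 ⟨?_, hne⟩))
      · simpa using this
      · rw [Module.End.mem_eigenspace_iff, Matrix.toLin'_apply, add_smul, ← hj]
        simp [Matrix.sub_mulVec, Matrix.smul_mulVec]
    have := hpos.dotProduct_mulVec_nonneg x
    simp only [star_trivial, hform] at this
    linarith
  · intro h μ hμ
    obtain ⟨x, hx⟩ := hμ.exists_hasEigenvector
    have h1 := h x
    have h2 := hx.apply_eq_smul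
    rw [Matrix.toLin'_apply] at h2
    rw [h2, dotProduct_smul, smul_eq_mul] at h1
    have hpos : 0 < x ⬝ᵥ x :=
      lt_of_le_of_ne (Finset.sum_nonneg fun i _ => mul_self_nonneg _)
        fun h0 => hx.2 (dotProduct_self_eq_zero.1 h0.symm)
    exact le_of_mul_le_mul_right h1 hpos

/-- The spectrum is finite, hence bounded below. This separates genuine widths from the value `⊥`,
by which the algorithm marks missing paths and the absence of a candidate. -/
theorem bot_lt_minEigenvalue {ι : Type} [Fintype ι] [DecidableEq ι] (A : Matrix ι ι ℝ) :
    ⊥ < minEigenvalue A := by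
  obtain ⟨r, hr⟩ := (Module.End.finite_hasEigenvalue (Matrix.toLin' A)).bddBelow
  exact (EReal.bot_lt_coe r).trans_le (le_iInf₂ fun μ hμ => EReal.coe_le_coe_iff.2 (hr hμ))

/-- On the vectors supported in `T`, the quadratic form of `A` is at least `r` times the squared
norm. -/
def FormBoundedBelowOn {V : Type} [Fintype V] (A : Matrix V V ℝ) (T : Set V) (r : ℝ) : Prop :=
  ∀ x : V → ℝ, (∀ v, v ∉ T → x v = 0) → r * (x ⬝ᵥ x) ≤ x ⬝ᵥ A *ᵥ x

theorem FormBoundedBelowOn.mono {V : Type} [Fintype V] {A : Matrix V V ℝ} {T T' : Set V} {r : ℝ}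
    (h : FormBoundedBelowOn A T r) (hT : T' ⊆ T) : FormBoundedBelowOn A T' r :=
  fun x hx => h x fun v hv => hx v fun h' => hv (hT h')

/-- Extension by zero along `e` preserves the norm and the form. Only the range of `e` matters, so
blocks with different index types become comparable. -/
theorem le_minEigenvalue_submatrix_iff {ι V : Type} [Fintype ι] [DecidableEq ι] [Fintype V]
    {A : Matrix V V ℝ} (hA : A.IsHermitian) {e : ι → V} (he : Function.Injective e) (r : ℝ) :
    (r : EReal) ≤ minEigenvalue (A.submatrix e e) ↔ FormBoundedBelowOn A (Set.range e) r := by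
  have hsq (x : V → ℝ) (hx : ∀ v, v ∉ Set.range e → x v = 0) :
      (x ∘ e) ⬝ᵥ (x ∘ e) = x ⬝ᵥ x :=
    Fintype.sum_of_injective e he _ _ (fun v hv => by simp [hx v hv]) fun i => rfl
  have hform (x : V → ℝ) (hx : ∀ v, v ∉ Set.range e → x v = 0) :
      (x ∘ e) ⬝ᵥ (A.submatrix e e) *ᵥ (x ∘ e) = x ⬝ᵥ A *ᵥ x := by
    refine Fintype.sum_of_injective e he _ _ (fun v hv => by simp [hx v hv]) fun i => ?_
    congr 1
    exact Fintype.sum_of_injective e he _ _ (fun v hv => by simp [hx v hv]) fun i => rfl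
  rw [le_minEigenvalue_iff (hA.submatrix e)]
  constructor
  · intro h x hx
    rw [← hsq x hx, ← hform x hx]
    exact h _
  · intro h y
    have hy : Function.extend e y 0 ∘ e = y := by
      ext i
      simp [he.extend_apply]
    have hsupp : ∀ v, v ∉ Set.range e → Function.extend e y 0 v = 0 := fun v hv => by
      rw [Function.extend_apply' _ _ _ (by simpa using hv)]
      rfl
    have := h _ hsupp
    rwa [← hsq _ hsupp, ← hform _ hsupp, hy] at this

/-- A vector supported in `T` is the sum of its restrictions to the classes of `label`. Entries of
`A` between classes vanish on `T`, so squared norm and form are both additive over these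
restrictions and the bounds on the classes add up. -/
theorem FormBoundedBelowOn.glue {V α : Type} [Fintype V] [DecidableEq α] {A : Matrix V V ℝ}
    {T : Set V} {r : ℝ} (label : V → α)
    (h : ∀ a, FormBoundedBelowOn A {v | v ∈ T ∧ label v = a} r)
    (hA : ∀ u ∈ T, ∀ v ∈ T, label u ≠ label v → A u v = 0) : FormBoundedBelowOn A T r := by
  intro x hx
  let y (a : α) (v : V) : ℝ := if label v = a then x v else 0
  have hy (a : α) : r * (y a ⬝ᵥ y a) ≤ y a ⬝ᵥ A *ᵥ y a := by
    refine h a _ fun v hv => ?_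
    by_cases hl : label v = a
    · have : v ∉ T := fun hT => hv ⟨hT, hl⟩
      simp [y, hx v this]
    · simp [y, hl]
  have hsum := Finset.sum_le_sum fun a (_ : a ∈ Finset.univ.image label) => hy a
  rw [← Finset.mul_sum] at hsum
  have hsq : ∑ a ∈ Finset.univ.image label, y a ⬝ᵥ y a = x ⬝ᵥ x := by
    simp only [dotProduct]
    rw [Finset.sum_comm]
    refine Finset.sum_congr rfl fun v _ => ?_
    rw [Finset.sum_eq_single (label v)] <;> simp +contextual [y, eq_comm]
  have hform : ∑ a ∈ Finset.univ.image label, y a ⬝ᵥ A *ᵥ y a = x ⬝ᵥ A *ᵥ x := by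
    simp only [dotProduct, mulVec]
    rw [Finset.sum_comm]
    refine Finset.sum_congr rfl fun v _ => ?_
    rw [Finset.sum_eq_single (label v)]
    · by_cases hv : v ∈ T
      · simp only [y, if_true]
        congr 1
        refine Finset.sum_congr rfl fun w _ => ?_
        -- The term at `w` is the same for `y (label v)` and `x`: outside `T` the vector vanishes,
        -- and in another class the matrix entry does.
        by_cases hw : w ∈ T
        · by_cases hl : label w = label v
          · simp [hl]
          · simp [hl, hA v hv w hw (Ne.symm hl)]
        · simp [hx w hw]
      · simp [y, hx v hv]
    · intro a _ ha
      simp [y, ha.symm]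
    · simp
  rwa [hsq, hform] at hsum

/-! ## Counted computations -/

namespace Counted

variable {α β : Type}

@[simp] theorem val_pure (a : α) : (pure a : Counted α).val = a := rfl

@[simp] theorem ops_pure (a : α) : (pure a : Counted α).ops = 0 := rfl

@[simp] theorem val_bind (x : Counted α) (f : α → Counted β) :
    (x >>= f).val = (f x.val).val := rfl

@[simp] theorem ops_bind (x : Counted α) (f : α → Counted β) :
    (x >>= f).ops = x.ops + (f x.val).ops := rfl

end Counted

section Basic

variable {ι κ α σ : Type}

@[simp] theorem val_op (a : α) : (op a).val = a := rfl

@[simp] theorem ops_op (a : α) : (op a).ops = 1 := rfl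

@[simp] theorem val_read (T : Table ι κ α) (i : ι) (j : κ) : (read T i j).val = T i j := rfl

@[simp] theorem ops_read (T : Table ι κ α) (i : ι) (j : κ) : (read T i j).ops = 1 := rfl

@[simp] theorem val_write [DecidableEq ι] [DecidableEq κ] (T : Table ι κ α) (i : ι) (j : κ)
    (x : α) : (write T i j x).val = Function.update T i (Function.update (T i) j x) := rfl

@[simp] theorem ops_write [DecidableEq ι] [DecidableEq κ] (T : Table ι κ α) (i : ι) (j : κ)
    (x : α) : (write T i j x).ops = 1 := rfl

theorem val_forEach (l : List ι) (body : ι → σ → Counted σ) (st : σ) :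
    (forEach l body st).val = l.foldl (fun st i => (body i st).val) st := by
  induction l generalizing st with
  | nil => rfl
  | cons i l ih => simp [forEach, ih]

theorem ops_forEach_le (l : List ι) (body : ι → σ → Counted σ) (st : σ) (B : ℕ)
    (h : ∀ i ∈ l, ∀ st, (body i st).ops ≤ B) : (forEach l body st).ops ≤ l.length * (B + 1) := by
  induction l generalizing st with
  | nil => simp [forEach]
  | cons i l ih =>
    have h1 := h i (by simp) st
    have h2 := ih (body i st).val fun j hj => h j (by simp [hj])
    simp only [forEach, Counted.ops_bind, ops_op, val_op, List.length_cons]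
    linarith

theorem foldl_update_row [DecidableEq ι] [DecidableEq κ] (i : ι) (g : κ → α) (l : List κ)
    (T : Table ι κ α) :
    l.foldl (fun T j => Function.update T i (Function.update (T i) j (g j))) T =
      Function.update T i (fun j => if j ∈ l then g j else T i j) := by
  induction l using List.reverseRecOn with
  | nil => simp
  | append_singleton l j ih =>
    rw [List.foldl_append, ih]
    simp only [List.foldl_cons, List.foldl_nil, Function.update_self, Function.update_idem]
    congr 1
    ext j'
    by_cases h : j' = j <;> simp [h]

theorem foldl_update [DecidableEq ι] (g : ι → α) (l : List ι) (T : ι → α) :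
    l.foldl (fun T i => Function.update T i (g i)) T = fun i => if i ∈ l then g i else T i := by
  induction l using List.reverseRecOn with
  | nil => simp
  | append_singleton l j ih =>
    rw [List.foldl_append, ih]
    ext j'
    by_cases h : j' = j <;> simp [h]

end Basic

/-! ## The Bellman–Ford iteration -/

section WidestPath

variable {V : Type}

theorem val_relax (G : WeightedDigraph V) (d : Table ℕ V EReal) (m : ℕ) (v : V) :
    (relax G d m v).val = G.verts.foldl (fun st u =>
      match G.weight u v with
      | none => st
      | some y => if st.1 < min (d m u) y then (min (d m u) y, some u) else st) (⊥, none) := by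
  rw [relax, val_forEach]
  congr 1
  ext1 st
  ext1 u
  simp only [Counted.val_bind, val_read]
  cases G.weight u v with
  | none => rfl
  | some y =>
    simp only [Counted.val_bind, val_read, val_op]
    by_cases h : st.1 < min (d m u) y <;> simp [h]

theorem relax_congr (G : WeightedDigraph V) {d d' : Table ℕ V EReal} {m : ℕ} (h : d m = d' m)
    (v : V) : (relax G d m v).val = (relax G d' m v).val := by
  rw [val_relax, val_relax, h]

theorem relax_spec (G : WeightedDigraph V) (d : Table ℕ V EReal) (m : ℕ) (v : V) :
    (∀ u ∈ G.verts, ∀ y, G.weight u v = some y → min (d m u) y ≤ (relax G d m v).val.1) ∧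
    (((relax G d m v).val.1 = ⊥ ∧ (relax G d m v).val.2 = none) ∨
      ∃ u ∈ G.verts, ∃ y, G.weight u v = some y ∧ (relax G d m v).val.1 = min (d m u) y ∧
        (relax G d m v).val.2 = some u) := by
  rw [val_relax]
  generalize G.verts = l
  induction l using List.reverseRecOn with
  | nil => simp
  | append_singleton l a ih =>
    simp only [List.foldl_append, List.foldl_cons, List.foldl_nil]
    generalize l.foldl _ _ = st at ih ⊢
    obtain ⟨h1, h2⟩ := ih
    have h2' : (st.1 = ⊥ ∧ st.2 = none) ∨ ∃ u ∈ l ++ [a], ∃ y, G.weight u v = some y ∧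
        st.1 = min (d m u) y ∧ st.2 = some u := by
      refine h2.imp id ?_
      rintro ⟨u, hu, h⟩
      exact ⟨u, by simp [hu], h⟩
    cases ha : G.weight a v with
    | none =>
      refine ⟨fun u hu y hy => ?_, h2'⟩
      rcases List.mem_append.1 hu with hu | hu
      · exact h1 u hu y hy
      · rw [List.mem_singleton.1 hu, ha] at hy
        cases hy
    | some z =>
      dsimp only
      split
      case isTrue hlt =>
        refine ⟨fun u hu y hy => ?_, Or.inr ⟨a, by simp, z, ha, rfl, rfl⟩⟩
        rcases List.mem_append.1 hu with hu | hu
        · exact (h1 u hu y hy).trans hlt.le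
        · rw [List.mem_singleton.1 hu, ha] at hy
          cases hy
          rw [List.mem_singleton.1 hu]
      case isFalse hlt =>
        refine ⟨fun u hu y hy => ?_, h2'⟩
        rcases List.mem_append.1 hu with hu | hu
        · exact h1 u hu y hy
        · rw [List.mem_singleton.1 hu, ha] at hy
          cases hy
          rw [List.mem_singleton.1 hu]
          exact not_lt.1 hlt

/-- Optimality only needs that decreasing the length leaves the width at `t` unchanged; minimality
of the resulting length plays no role. -/
theorem shortestLength_spec (d : Table ℕ V EReal) (t : V) (H : ℕ) :
    (shortestLength d t H).val ≤ H ∧ d (shortestLength d t H).val t = d H t ∧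
      (shortestLength d t H).ops ≤ 4 * H := by
  induction H with
  | zero => simp [shortestLength]
  | succ H ih =>
    by_cases h : d (H + 1) t = d H t
    · simp only [shortestLength, Counted.val_bind, val_read, val_op, Counted.ops_bind, ops_read,
        ops_op, h, decide_true, if_true]
      exact ⟨ih.1.trans (Nat.le_succ _), ih.2.1, by omega⟩
    · simp only [shortestLength, Counted.val_bind, val_read, val_op, Counted.ops_bind, ops_read,
        ops_op, h, decide_false, Bool.false_eq_true, if_false, Counted.val_pure, Counted.ops_pure]
      exact ⟨le_rfl, trivial, by omega⟩

theorem ops_tracePath_le (pred : Table ℕ V (Option V)) (l : ℕ) (v : V) :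
    (tracePath pred l v).ops ≤ 2 * l + 2 := by
  induction l generalizing v with
  | zero => simp [tracePath]
  | succ l ih =>
    simp only [tracePath, Counted.ops_bind, ops_read, val_read]
    cases pred (l + 1) v with
    | none => simp
    | some u =>
      have := ih u
      simp only [Counted.ops_bind, ops_op]
      omega

theorem length_tracePath_le (pred : Table ℕ V (Option V)) (l : ℕ) (v : V) :
    (tracePath pred l v).val.length ≤ l + 1 := by
  induction l generalizing v with
  | zero => simp [tracePath]
  | succ l ih =>
    simp only [tracePath, Counted.val_bind, val_read]
    cases pred (l + 1) v with
    | none => simp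
    | some u => simpa using ih u

theorem ops_relax_le (G : WeightedDigraph V) (d : Table ℕ V EReal) (m : ℕ) (v : V) :
    (relax G d m v).ops ≤ G.verts.length * 5 := by
  refine ops_forEach_le _ _ _ 4 fun u _ st => ?_
  simp only [Counted.ops_bind, ops_read, val_read]
  cases G.weight u v with
  | none => simp
  | some y =>
    simp only [Counted.ops_bind, ops_read, ops_op, val_op, val_read]
    by_cases h : st.1 < min (d m u) y <;> simp [h]

variable [DecidableEq V]

/-- The tables of widths and of predecessors that `widestPath` computes. -/
noncomputable def bellmanFord (G : WeightedDigraph V) (s : V) (H : ℕ) :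
    Counted (Table ℕ V EReal × Table ℕ V (Option V)) := do
  let d ← forEach (List.range (H + 1)) (fun m d =>
    forEach G.verts (fun v d => write d m v ⊥) d) (fun _ _ => 0)
  let d ← write d 0 s ⊤
  let pred ← forEach (List.range (H + 1)) (fun m pred =>
    forEach G.verts (fun v pred => write pred m v none) pred) (fun _ _ => none)
  forEach (List.range H) (fun m (st : Table ℕ V EReal × Table ℕ V (Option V)) =>
    forEach G.verts (fun v (st : Table ℕ V EReal × Table ℕ V (Option V)) => do
      let best ← relax G st.1 m v
      let d ← write st.1 (m + 1) v best.1
      let pred ← write st.2 (m + 1) v best.2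
      pure (d, pred)) st) (d, pred)

/-- The iteration is split off from the tracing so that its tables can be named. Regrouping the
binds preserves the count because addition of costs is associative. -/
theorem widestPath_eq (G : WeightedDigraph V) (s t : V) (H : ℕ) :
    widestPath G s t H = (do
      let st ← bellmanFord G s H
      let l ← shortestLength st.1 t H
      let P ← tracePath st.2 l t
      let w ← read st.1 l t
      pure (P, w)) := by
  have assoc {α β γ : Type} (x : Counted α) (f : α → Counted β) (g : β → Counted γ) :
      (x >>= f) >>= g = x >>= fun a => f a >>= g := by
    change Counted.mk _ _ = Counted.mk _ _
    congr 1
    exact Nat.add_assoc _ _ _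
  simp only [bellmanFord, assoc]
  rfl

/-- A round writes only to row `m + 1` and reads only row `m` of the widths, so updating in place
agrees with updating all vertices simultaneously. -/
theorem foldl_relax_row (G : WeightedDigraph V) (m : ℕ) (l : List V)
    (st : Table ℕ V EReal × Table ℕ V (Option V)) :
    l.foldl (fun st v => (Function.update st.1 (m + 1)
        (Function.update (st.1 (m + 1)) v (relax G st.1 m v).val.1),
      Function.update st.2 (m + 1)
        (Function.update (st.2 (m + 1)) v (relax G st.1 m v).val.2))) st =
    (Function.update st.1 (m + 1)
        (fun v => if v ∈ l then (relax G st.1 m v).val.1 else st.1 (m + 1) v),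
      Function.update st.2 (m + 1)
        (fun v => if v ∈ l then (relax G st.1 m v).val.2 else st.2 (m + 1) v)) := by
  induction l using List.reverseRecOn with
  | nil => simp
  | append_singleton l a ih =>
    rw [List.foldl_append, ih]
    simp only [List.foldl_cons, List.foldl_nil, Function.update_self, Function.update_idem]
    rw [relax_congr G (d' := st.1) (by simp)]
    congr 2 <;>
    · ext1 v
      by_cases h : v = a <;> simp [h]

theorem bellmanFord_spec (G : WeightedDigraph V) (s : V) (H : ℕ) :
    (∀ v ∈ G.verts, (bellmanFord G s H).val.1 0 v = if v = s then ⊤ else ⊥) ∧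
    ∀ m < H, ∀ v ∈ G.verts,
      (bellmanFord G s H).val.1 (m + 1) v = (relax G (bellmanFord G s H).val.1 m v).val.1 ∧
      (bellmanFord G s H).val.2 (m + 1) v = (relax G (bellmanFord G s H).val.1 m v).val.2 := by
  simp only [bellmanFord, Counted.val_bind, val_forEach, val_write, Counted.val_pure,
    foldl_relax_row]
  generalize hd : Function.update _ 0 _ = d
  have hd0 : ∀ v ∈ G.verts, d 0 v = if v = s then ⊤ else ⊥ := by
    intro v hv
    rw [← hd]
    by_cases hs : v = s
    · simp [hs]
    · simp only [Function.update_self, Function.update_of_ne hs, if_neg hs, List.range_succ_eq_map,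
        List.foldl_cons]
      -- An entry of row `0` that is already `⊥` stays so during the rest of the initialization,
      -- whichever rows are visited.
      have hrow : ∀ (L : List ℕ) (T : Table ℕ V EReal), T 0 v = ⊥ →
          L.foldl (fun T m => G.verts.foldl (fun T j =>
            Function.update T m (Function.update (T m) j ⊥)) T) T 0 v = ⊥ := by
        intro L
        induction L with
        | nil => exact fun T hT => hT
        | cons m L ih =>
          intro T hT
          refine ih _ ?_
          dsimp only
          rw [foldl_update_row m (fun _ => ⊥)]
          by_cases hm : m = 0
          · subst hm
            simp [hv]
          · rw [Function.update_of_ne (Ne.symm hm), hT]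
      apply hrow
      rw [foldl_update_row 0 (fun _ => ⊥)]
      simp [hv]
  -- The initial predecessor table is arbitrary from here on: the entries that are described are all
  -- overwritten.
  generalize List.foldl _ _ (List.range (H + 1)) = p
  clear hd
  induction H with
  | zero => exact ⟨hd0, by simp⟩
  | succ H ih =>
    rw [List.range_succ, List.foldl_append]
    generalize List.foldl _ _ (List.range H) = st at ih ⊢
    simp only [List.foldl_cons, List.foldl_nil]
    refine ⟨fun v hv => ?_, fun m hm v hv => ?_⟩
    · rw [Function.update_of_ne (by simp)]
      exact ih.1 v hv
    · rcases Nat.lt_succ_iff_lt_or_eq.1 hm with hm | rfl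
      · rw [Function.update_of_ne (by omega), Function.update_of_ne (by omega),
          relax_congr G (d' := st.1) (Function.update_of_ne (by omega) _ _)]
        exact ih.2 m hm v hv
      · rw [relax_congr G (d' := st.1) (Function.update_of_ne (by omega) _ _)]
        simp [hv]

/-- The vertices of the path found by `tracePath` are those of a walk from `s` whose edge weights
are at least the width recorded in the table. -/
theorem tracePath_spec (G : WeightedDigraph V) (s : V) {H l : ℕ} (hl : l ≤ H) {v : V}
    (hv : v ∈ G.verts) (hbot : ⊥ < (bellmanFord G s H).val.1 l v) :
    ∃ w : ℕ → V, w 0 = s ∧ w l = v ∧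
      (∀ j < l, ∃ y, G.weight (w j) (w (j + 1)) = some y ∧ (bellmanFord G s H).val.1 l v ≤ y) ∧
      ∀ x, x ∈ (tracePath (bellmanFord G s H).val.2 l v).val ↔ ∃ j ≤ l, w j = x := by
  induction l generalizing v with
  | zero =>
    have hs : v = s := by
      by_contra hs
      rw [(bellmanFord_spec G s H).1 v hv, if_neg hs] at hbot
      exact lt_irrefl _ hbot
    refine ⟨fun _ => s, rfl, hs.symm, by simp, fun x => ?_⟩
    simp [tracePath, hs, eq_comm]
  | succ l ih =>
    obtain ⟨h1, h2⟩ := (bellmanFord_spec G s H).2 l hl v hv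
    rcases (relax_spec G (bellmanFord G s H).val.1 l v).2 with ⟨h, -⟩ | ⟨u, hu, y, hy, hmin, hp⟩
    · rw [h1, h] at hbot
      exact absurd hbot (lt_irrefl _)
    · rw [hmin] at h1
      rw [hp] at h2
      rw [h1] at hbot
      obtain ⟨w, hw0, hwl, hw, hmem⟩ := ih (by omega) hu (lt_min_iff.1 hbot).1
      -- The walk to the recorded predecessor `u` is prolonged by the edge to `v`; its weight and
      -- the width at `u` are the two arguments of the minimum.
      refine ⟨fun j => if j ≤ l then w j else v, by simpa using hw0, by simp, fun j hj => ?_,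
        fun x => ?_⟩
      · rw [h1]
        rcases Nat.lt_succ_iff_lt_or_eq.1 hj with hj | rfl
        · obtain ⟨z, hz, hle⟩ := hw j hj
          exact ⟨z, by simpa [hj.le, Nat.succ_le_iff.2 hj] using hz, (min_le_left _ _).trans hle⟩
        · exact ⟨y, by simpa [hwl] using hy, min_le_right _ _⟩
      · simp only [tracePath, Counted.val_bind, val_read, h2, val_op, List.mem_cons, hmem]
        constructor
        · rintro (rfl | ⟨j, hj, rfl⟩)
          · exact ⟨l + 1, le_rfl, by simp⟩
          · exact ⟨j, by omega, by simp [hj]⟩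
        · rintro ⟨j, hj, rfl⟩
          by_cases hjl : j ≤ l
          · exact Or.inr ⟨j, hjl, by simp [hjl]⟩
          · exact Or.inl (by simp [hjl])

/-- The recorded width is at least the least edge weight of any walk from `s`. -/
theorem le_bellmanFord (G : WeightedDigraph V) (s : V) {H : ℕ} (w : ℕ → V) {l : ℕ} (hl : l ≤ H)
    (hw0 : w 0 = s) (hw : ∀ j ≤ l, w j ∈ G.verts) {r : EReal}
    (hr : ∀ j < l, ∃ y, G.weight (w j) (w (j + 1)) = some y ∧ r ≤ y) :
    r ≤ (bellmanFord G s H).val.1 l (w l) := by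
  induction l with
  | zero =>
    rw [(bellmanFord_spec G s H).1 _ (hw 0 le_rfl), if_pos hw0]
    exact le_top
  | succ l ih =>
    rw [((bellmanFord_spec G s H).2 l hl _ (hw _ le_rfl)).1]
    obtain ⟨y, hy, hle⟩ := hr l (by omega)
    exact (le_min (ih (by omega) (fun j hj => hw j (by omega)) fun j hj => hr j (by omega))
      hle).trans ((relax_spec G _ l _).1 _ (hw l (by omega)) y hy)

theorem ops_bellmanFord_le (G : WeightedDigraph V) (s : V) (H : ℕ) :
    (bellmanFord G s H).ops ≤ 2 * ((H + 1) * (G.verts.length * 2 + 1)) + 1 +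
      H * (G.verts.length * (G.verts.length * 5 + 3) + 1) := by
  have h1 {α : Type} (a : α) (T : Table ℕ V α) :
      (forEach (List.range (H + 1)) (fun m d =>
        forEach G.verts (fun v d => write d m v a) d) T).ops ≤
        (H + 1) * (G.verts.length * 2 + 1) := by
    simpa using ops_forEach_le (List.range (H + 1)) (fun m d =>
      forEach G.verts (fun v d => write d m v a) d) T (G.verts.length * 2)
      fun m _ d => ops_forEach_le _ _ _ 1 fun v _ d => by simp
  have h2 (st : Table ℕ V EReal × Table ℕ V (Option V)) :
      (forEach (List.range H) (fun m (st : Table ℕ V EReal × Table ℕ V (Option V)) =>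
        forEach G.verts (fun v (st : Table ℕ V EReal × Table ℕ V (Option V)) => do
          let best ← relax G st.1 m v
          let d ← write st.1 (m + 1) v best.1
          let pred ← write st.2 (m + 1) v best.2
          pure (d, pred)) st) st).ops ≤
        H * (G.verts.length * (G.verts.length * 5 + 3) + 1) := by
    refine (ops_forEach_le _ _ _ (G.verts.length * (G.verts.length * 5 + 3))
      fun m _ st => ops_forEach_le _ _ _ (G.verts.length * 5 + 2) fun v _ st => ?_).trans_eq ?_
    · have := ops_relax_le G st.1 m v
      simp only [Counted.ops_bind, ops_write, Counted.ops_pure]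
      omega
    · simp
  simp only [bellmanFord, Counted.ops_bind, ops_write]
  calc _ ≤ (H + 1) * (G.verts.length * 2 + 1) + (1 + ((H + 1) * (G.verts.length * 2 + 1) +
        H * (G.verts.length * (G.verts.length * 5 + 3) + 1))) :=
      add_le_add (h1 _ _) (Nat.add_le_add_left (add_le_add (h1 _ _) (h2 _)) _)
    _ = _ := by ring

theorem ops_widestPath_le (G : WeightedDigraph V) (s t : V) (H : ℕ) :
    (widestPath G s t H).ops ≤ 2 * ((H + 1) * (G.verts.length * 2 + 1)) +
      H * (G.verts.length * (G.verts.length * 5 + 3) + 1) + 6 * H + 4 := by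
  rw [widestPath_eq]
  simp only [Counted.ops_bind, ops_read, Counted.ops_pure]
  have h1 := ops_bellmanFord_le G s H
  obtain ⟨h2, -, h3⟩ := shortestLength_spec (bellmanFord G s H).val.1 t H
  have h4 := ops_tracePath_le (bellmanFord G s H).val.2
    (shortestLength (bellmanFord G s H).val.1 t H).val t
  omega

end WidestPath

/-! ## The Laplacian of the ring -/

section Ring

variable {n : ℕ}

theorem mod_eq_ite {a n : ℕ} (h : a < 2 * n) : a % n = if a < n then a else a - n := by
  split
  case isTrue h' => exact Nat.mod_eq_of_lt h'
  case isFalse h' =>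
    rw [Nat.mod_eq_sub_mod (not_lt.1 h'), Nat.mod_eq_of_lt (by omega)]

theorem val_next (p : Fin n) : (next p : ℕ) = if (p : ℕ) + 1 < n then (p : ℕ) + 1 else 0 := by
  have := p.isLt
  refine (mod_eq_ite (by omega)).trans ?_
  split <;> omega

theorem val_prev (p : Fin n) : (prev p : ℕ) = if (p : ℕ) = 0 then n - 1 else (p : ℕ) - 1 := by
  have := p.isLt
  refine (mod_eq_ite (by omega)).trans ?_
  split <;> split <;> omega

theorem cycleGraph_adj_iff (hn : 3 ≤ n) (i j : Fin n) :
    (SimpleGraph.cycleGraph n).Adj i j ↔ j = prev i ∨ j = next i := by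
  have hi := i.isLt
  have hj := j.isLt
  rw [SimpleGraph.cycleGraph_adj', Fin.ext_iff, Fin.ext_iff, val_next, val_prev, Fin.val_sub,
    Fin.val_sub, mod_eq_ite (by omega), mod_eq_ite (by omega)]
  grind

/-- For `n = 2` the two neighbours would coincide and the diagonal entry would count one edge twice;
this is where `3 ≤ n` enters. -/
theorem prev_ne_next (hn : 3 ≤ n) (i : Fin n) : prev i ≠ next i := by
  have := i.isLt
  rw [Ne, Fin.ext_iff, val_next, val_prev]
  grind

/-- The cases are ordered as the writes of `computeLaplacian`, the last write first. -/
theorem weightedLaplacian_cycleGraph (hn : 3 ≤ n) (W : Fin n → Fin n → ℝ) (i j : Fin n) :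
    weightedLaplacian (SimpleGraph.cycleGraph n) W i j =
      if j = i then W i (prev i) + W i (next i)
      else if j = next i then - W i (next i)
      else if j = prev i then - W i (prev i) else 0 := by
  have hnb : (SimpleGraph.cycleGraph n).neighborFinset i = {prev i, next i} := by
    ext j
    simp [cycleGraph_adj_iff hn]
  simp only [weightedLaplacian, Matrix.of_apply, hnb, cycleGraph_adj_iff hn,
    Finset.sum_pair (prev_ne_next hn i), eq_comm (a := i)]
  grind

theorem val_computeLaplacian (hn : 3 ≤ n) (W : Fin n → Fin n → ℝ) :
    (computeLaplacian W).val =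
      fun i j => weightedLaplacian (SimpleGraph.cycleGraph n) W i j := by
  simp only [computeLaplacian, val_forEach, Counted.val_bind, val_write, val_op, val_read,
    foldl_update_row _ (fun _ => (0 : ℝ)), Function.update_self, Function.update_idem,
    List.mem_finRange, if_true]
  rw [foldl_update (fun i => Function.update (Function.update (Function.update
    (fun _ => 0) (prev i) (-W i (prev i))) (next i) (-W i (next i))) i
    (W i (prev i) + W i (next i)))]
  ext i j
  simp [weightedLaplacian_cycleGraph hn, Function.update_apply]

theorem isHermitian_weightedLaplacian (W : Fin n → Fin n → ℝ)
    (hW : ∀ i j : Fin n, (SimpleGraph.cycleGraph n).Adj i j → W i j = W j i) :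
    (weightedLaplacian (SimpleGraph.cycleGraph n) W).IsHermitian := by
  ext i j
  simp only [conjTranspose_apply, star_trivial, weightedLaplacian, of_apply, eq_comm (a := j),
    SimpleGraph.adj_comm _ j i]
  grind

theorem weightedLaplacian_eq_zero (hn : 3 ≤ n) (W : Fin n → Fin n → ℝ) {i j : Fin n}
    (h : j ≠ i) (h1 : j ≠ next i) (h2 : j ≠ prev i) :
    weightedLaplacian (SimpleGraph.cycleGraph n) W i j = 0 := by
  simp [weightedLaplacian_cycleGraph hn, h, h1, h2]

/-! ## Segments of the ring -/

/-- The node `f` lies strictly between `u` and `v` in clockwise order from `u` to `v`; for `u = v`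
these are all nodes other than `u`. -/
def StrictlyBetween (u v f : Fin n) : Prop :=
  (u < f ∧ f < v) ∨ (v ≤ u ∧ (u < f ∨ f < v))

/-- The number of nodes strictly between `u` and `v`. -/
def segmentLength (u v : Fin n) : ℕ := ((v : ℕ) + (n - 1) - u) % n

theorem segmentLength_eq (u v : Fin n) :
    segmentLength u v = if u < v then (v : ℕ) - u - 1 else (v : ℕ) + (n - 1) - u := by
  have := u.isLt
  have := v.isLt
  rw [segmentLength, mod_eq_ite (by omega)]
  simp only [Fin.lt_def]
  split <;> split <;> omega

/-- The node reached from `u` after `j + 1` steps in clockwise order. -/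
def nodeAfter (u : Fin n) (j : ℕ) : Fin n := next^[j] (next u)

theorem nodeAfter_succ (u : Fin n) (j : ℕ) : nodeAfter u (j + 1) = next (nodeAfter u j) :=
  Function.iterate_succ_apply' _ _ _

theorem val_nodeAfter (u : Fin n) {j : ℕ} (hj : j < n) :
    (nodeAfter u j : ℕ) = if (u : ℕ) + 1 + j < n then (u : ℕ) + 1 + j else (u : ℕ) + 1 + j - n := by
  have := u.isLt
  induction j with
  | zero =>
    rw [nodeAfter, Function.iterate_zero, id_eq, val_next]
    grind
  | succ j ih =>
    rw [nodeAfter_succ, val_next, ih (by omega)]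
    grind

theorem val_segmentWeight (c : ℕ) (L : Table (Fin n) (Fin n) ℝ) (u v : Fin n) :
    (segmentWeight c L u v).val = minEigenvalue (tridiagonal (segmentLength u v)
      (fun j => if j < segmentLength u v then L (nodeAfter u j) (nodeAfter u j) else 0)
      (fun j => if j < segmentLength u v then L (nodeAfter u j) (nodeAfter u (j + 1)) else 0)) := by
  -- Loop invariant: after `m` iterations the current node is `nodeAfter u m` and the first `m` rows
  -- are filled, while later rows keep the default `0`.
  have hfold (m : ℕ) : (List.range m).foldl (fun (st : Fin n × Table ℕ Bool ℝ) j =>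
      (next st.1, Function.update (Function.update st.2 j (Function.update (st.2 j) false
        (L st.1 st.1))) j (Function.update (Function.update st.2 j (Function.update (st.2 j) false
        (L st.1 st.1)) j) true (L st.1 (next st.1))))) (next u, fun _ _ => 0) =
      (nodeAfter u m, fun j b => if j < m then
        if b then L (nodeAfter u j) (nodeAfter u (j + 1)) else L (nodeAfter u j) (nodeAfter u j)
        else 0) := by
    induction m with
    | zero => simp [nodeAfter]
    | succ m ih =>
      rw [List.range_succ, List.foldl_append, ih]
      simp only [List.foldl_cons, List.foldl_nil, Function.update_self, Function.update_idem,
        nodeAfter_succ, Prod.mk.injEq, true_and]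
      ext j b
      by_cases hj : j = m
      · subst hj
        cases b <;> simp
      · have : j < m + 1 ↔ j < m := by omega
        simp [Function.update_of_ne hj, this]
  simp only [segmentWeight, tridiagonalMinEigenvalue, Counted.val_bind, val_op, val_read,
    val_write, Counted.val_pure, val_forEach]
  rw [hfold]
  rfl

theorem val_segmentWeights (c : ℕ) (L : Table (Fin n) (Fin n) ℝ) (u v : Fin n) :
    (segmentWeights c L).val u v = (segmentWeight c L u v).val := by
  simp only [segmentWeights, val_forEach, Counted.val_bind, val_write]
  have (u : Fin n) (T : Table (Fin n) (Fin n) EReal) := foldl_update_row u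
    (fun v => (segmentWeight c L u v).val) (List.finRange n) T
  simp only [this, List.mem_finRange, if_true]
  rw [foldl_update (fun u v => (segmentWeight c L u v).val)]
  simp

/-- A segment misses `u`, so it is a path cut out of the ring: nodes whose positions differ by more
than one are not adjacent, even when the segment has all `n - 1` other nodes. -/
theorem tridiagonal_segment (hn : 3 ≤ n) (W : Fin n → Fin n → ℝ)
    (hW : ∀ i j : Fin n, (SimpleGraph.cycleGraph n).Adj i j → W i j = W j i) (u v : Fin n) :
    tridiagonal (segmentLength u v)
      (fun j => if j < segmentLength u v then weightedLaplacian (SimpleGraph.cycleGraph n) W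
        (nodeAfter u j) (nodeAfter u j) else 0)
      (fun j => if j < segmentLength u v then weightedLaplacian (SimpleGraph.cycleGraph n) W
        (nodeAfter u j) (nodeAfter u (j + 1)) else 0) =
    (weightedLaplacian (SimpleGraph.cycleGraph n) W).submatrix
      (fun j : Fin (segmentLength u v) => nodeAfter u j)
      (fun j : Fin (segmentLength u v) => nodeAfter u j) := by
  have hm : segmentLength u v < n := Nat.mod_lt _ u.pos
  have hu := u.isLt
  ext i j
  have hi := i.isLt
  have hj := j.isLt
  simp only [tridiagonal, of_apply, submatrix_apply, hi, hj, if_true]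
  split
  case isTrue h => rw [h]
  case isFalse h =>
    split
    case isTrue h1 => rw [h1]
    case isFalse h1 =>
      split
      case isTrue h2 =>
        rw [h2]
        exact (isHermitian_weightedLaplacian W hW).apply _ _
      case isFalse h2 =>
        have h0 : (i : ℕ) ≠ j := fun h' => h (Fin.ext h')
        refine (weightedLaplacian_eq_zero hn W ?_ ?_ ?_).symm <;>
        · simp only [Ne, Fin.ext_iff, val_next, val_prev, val_nodeAfter u (hi.trans hm),
            val_nodeAfter u (hj.trans hm)]
          grind

theorem range_nodeAfter (u v : Fin n) :
    Set.range (fun j : Fin (segmentLength u v) => nodeAfter u j) =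
      {f | StrictlyBetween u v f} := by
  have hm : segmentLength u v < n := Nat.mod_lt _ u.pos
  have hu := u.isLt
  have hv := v.isLt
  have hlen := segmentLength_eq u v
  simp only [Fin.lt_def] at hlen
  ext f
  have hf := f.isLt
  simp only [Set.mem_range, Set.mem_ofPred_eq, StrictlyBetween, Fin.lt_def, Fin.le_def]
  constructor
  · rintro ⟨j, rfl⟩
    have hj := j.isLt
    rw [val_nodeAfter u (hj.trans hm)]
    grind
  · intro h
    refine ⟨⟨if (u : ℕ) < f then f - u - 1 else f + n - u - 1, by grind⟩, Fin.ext ?_⟩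
    rw [val_nodeAfter u (by grind)]
    grind

theorem nodeAfter_injective (u v : Fin n) :
    Function.Injective (fun j : Fin (segmentLength u v) => nodeAfter u j) := by
  have hm : segmentLength u v < n := Nat.mod_lt _ u.pos
  have hu := u.isLt
  intro i j hij
  have hi := i.isLt
  have hj := j.isLt
  have := congrArg Fin.val hij
  simp only [val_nodeAfter u (hi.trans hm), val_nodeAfter u (hj.trans hm)] at this
  ext
  grind

theorem segmentWeights_eq (hn : 3 ≤ n) (c : ℕ) (W : Fin n → Fin n → ℝ)
    (hW : ∀ i j : Fin n, (SimpleGraph.cycleGraph n).Adj i j → W i j = W j i) (u v : Fin n) :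
    (segmentWeights c (computeLaplacian W).val).val u v =
      minEigenvalue ((weightedLaplacian (SimpleGraph.cycleGraph n) W).submatrix
        (fun j : Fin (segmentLength u v) => nodeAfter u j)
        (fun j : Fin (segmentLength u v) => nodeAfter u j)) := by
  rw [val_segmentWeights, val_segmentWeight, ← tridiagonal_segment hn W hW]
  simp only [val_computeLaplacian hn]

theorem le_segmentWeights_iff (hn : 3 ≤ n) (c : ℕ) (W : Fin n → Fin n → ℝ)
    (hW : ∀ i j : Fin n, (SimpleGraph.cycleGraph n).Adj i j → W i j = W j i) (u v : Fin n)
    (r : ℝ) :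
    (r : EReal) ≤ (segmentWeights c (computeLaplacian W).val).val u v ↔
      FormBoundedBelowOn (weightedLaplacian (SimpleGraph.cycleGraph n) W)
        {f | StrictlyBetween u v f} r := by
  rw [segmentWeights_eq hn c W hW, le_minEigenvalue_submatrix_iff
    (isHermitian_weightedLaplacian W hW) (nodeAfter_injective u v), range_nodeAfter]

theorem le_convergenceRate_iff (W : Fin n → Fin n → ℝ)
    (hW : ∀ i j : Fin n, (SimpleGraph.cycleGraph n).Adj i j → W i j = W j i)
    (S : Finset (Fin n)) (r : ℝ) :
    (r : EReal) ≤ convergenceRate W S ↔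
      FormBoundedBelowOn (weightedLaplacian (SimpleGraph.cycleGraph n) W) {f | f ∉ S} r := by
  rw [convergenceRate, followerBlock, le_minEigenvalue_submatrix_iff
    (isHermitian_weightedLaplacian W hW) Subtype.val_injective, Subtype.range_val_subtype]

theorem convergenceRate_mono (W : Fin n → Fin n → ℝ)
    (hW : ∀ i j : Fin n, (SimpleGraph.cycleGraph n).Adj i j → W i j = W j i)
    {S S' : Finset (Fin n)} (h : S ⊆ S') : convergenceRate W S ≤ convergenceRate W S' :=
  le_of_forall_real_le fun r hr => by
    rw [le_convergenceRate_iff W hW] at hr ⊢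
    exact hr.mono fun f hf hfS => hf (h hfS)

/-! ## Closed walks in the ring -/

/-- A closed walk around the ring passes every node that it does not visit. -/
theorem exists_strictlyBetween {l : ℕ} (hl : 1 ≤ l) (p : ℕ → Fin n) (hp : p l = p 0) {f : Fin n}
    (hf : ∀ j < l, p j ≠ f) : ∃ j < l, StrictlyBetween (p j) (p (j + 1)) f := by
  by_contra! hcon
  have hf' : ∀ j ≤ l, p j ≠ f := by
    intro j hj
    rcases hj.lt_or_eq with hj | rfl
    · exact hf j hj
    · rw [hp]
      exact hf 0 hl
  -- The clockwise distance from `f` to `x`, with value `n` at `f` itself. A step that does not pass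
  -- `f` strictly increases it, which a closed walk of positive length cannot do throughout.
  let pos (x : Fin n) : ℕ := if f < x then (x : ℕ) - f else x + n - f
  have hpos : ∀ j ≤ l, pos (p 0) + j ≤ pos (p j) := by
    intro j
    induction j with
    | zero => simp
    | succ j ih =>
      intro hj
      have h1 := ih (by omega)
      have h2 := hcon j (by omega)
      have h3 := hf' j (by omega)
      have h4 := hf' (j + 1) hj
      have h5 : pos (p j) < pos (p (j + 1)) := by
        simp only [pos, StrictlyBetween, Fin.lt_def, Fin.le_def, Ne, Fin.ext_iff] at h2 h3 h4 ⊢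
        have := (p j).isLt
        have := (p (j + 1)).isLt
        have := f.isLt
        grind
      omega
  have := hpos l le_rfl
  rw [hp] at this
  omega

/-- Along the ring, a segment can be entered or left only through one of its endpoints. -/
theorem strictlyBetween_iff_of_adj {u v f g : Fin n} (hg : g = next f ∨ g = prev f)
    (hfu : f ≠ u) (hfv : f ≠ v) (hgu : g ≠ u) (hgv : g ≠ v) :
    StrictlyBetween u v f ↔ StrictlyBetween u v g := by
  have := u.isLt
  have := v.isLt
  have := f.isLt
  simp only [StrictlyBetween, Fin.lt_def, Fin.le_def, Ne, Fin.ext_iff, val_next, val_prev] at *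
  grind

/-- The convergence rate of the set of the nodes visited by a closed walk is at least the width of
the walk. -/
theorem le_convergenceRate_of_walk (hn : 3 ≤ n) (c : ℕ) (W : Fin n → Fin n → ℝ)
    (hW : ∀ i j : Fin n, (SimpleGraph.cycleGraph n).Adj i j → W i j = W j i)
    {l : ℕ} (hl : 1 ≤ l) (p : ℕ → Fin n) (hp : p l = p 0) {S : Finset (Fin n)}
    (hS : ∀ j < l, p j ∈ S) {a : EReal}
    (ha : ∀ j < l, a ≤ (segmentWeights c (computeLaplacian W).val).val (p j) (p (j + 1))) :
    a ≤ convergenceRate W S := by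
  classical
  refine le_of_forall_real_le fun r hr => ?_
  rw [le_convergenceRate_iff W hW]
  have hS' : ∀ j ≤ l, p j ∈ S := by
    intro j hj
    rcases hj.lt_or_eq with hj | rfl
    · exact hS j hj
    · rw [hp]
      exact hS 0 hl
  -- Followers are labelled by the set of all steps whose segments contain them. A single segment
  -- would not be a canonical label, since those of a walk winding several times overlap.
  refine FormBoundedBelowOn.glue
    (fun f => {j | j < l ∧ StrictlyBetween (p j) (p (j + 1)) f}) (fun J => ?_) ?_
  · by_cases hJ : ∃ j, j < l ∧ j ∈ J
    · obtain ⟨j, hj, hjJ⟩ := hJ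
      refine ((le_segmentWeights_iff hn c W hW _ _ r).1 (hr.trans (ha j hj))).mono ?_
      rintro f ⟨-, rfl⟩
      exact hjJ.2
    -- No follower carries a label without steps, so the class is empty and the bound of any segment
    -- will do.
    · refine ((le_segmentWeights_iff hn c W hW _ _ r).1 (hr.trans (ha 0 hl))).mono ?_
      rintro f ⟨hf, rfl⟩
      obtain ⟨j, hj, hb⟩ := exists_strictlyBetween hl p hp (f := f)
        fun j hj h => hf (h ▸ hS j hj)
      exact absurd ⟨j, hj, hj, hb⟩ hJ
  · intro f hf g hg hne
    by_contra h0
    apply hne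
    by_cases hgf : g = f
    · rw [hgf]
    have hadj : g = next f ∨ g = prev f := by
      by_contra! h
      exact h0 (weightedLaplacian_eq_zero hn W hgf h.1 h.2)
    ext j
    refine and_congr_right fun hj => ?_
    exact strictlyBetween_iff_of_adj hadj (fun h => hf (h ▸ hS' j hj.le))
      (fun h => hf (h ▸ hS' (j + 1) hj)) (fun h => hg (h ▸ hS' j hj.le))
      (fun h => hg (h ▸ hS' (j + 1) hj))

end Ring

/-! ## The digraph for an initial leader -/

section Digraph

variable {n : ℕ}

/-- The node of the ring that a vertex of the digraph for the initial leader `i` stands for. -/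
def Vertex.label (i : Fin n) : Vertex n → Fin n
  | .source => i
  | .target => i
  | .node v => v

theorem edgeWeight_label {R : Table (Fin n) (Fin n) EReal} {i : Fin n} {x y : Vertex n}
    {z : EReal} (h : (edgeWeight R i x y).val = some z) : z = R (x.label i) (y.label i) := by
  cases x <;> cases y <;> simp only [edgeWeight, Counted.val_bind, val_op, val_read,
    Counted.val_pure, Option.some.injEq, reduceCtorEq] at h
  · exact h.symm
  · exact h.symm
  · exact h.symm
  · rename_i u v
    by_cases huv : u = v
    · simp [huv] at h
    · simp only [huv, decide_false, Bool.false_eq_true, if_false, Counted.val_bind, val_read,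
        Counted.val_pure, Option.some.injEq] at h
      exact h.symm

theorem ops_edgeWeight_le (R : Table (Fin n) (Fin n) EReal) (i : Fin n) (x y : Vertex n) :
    (edgeWeight R i x y).ops ≤ 2 := by
  cases x <;> cases y <;> simp only [edgeWeight, Counted.ops_bind, ops_op, ops_read,
    Counted.ops_pure] <;> try omega
  rename_i u v
  by_cases huv : u = v <;> simp [huv]

/-- Entries outside the block keep their initial value; for the weight table this is `none`, so
edges exist only between listed vertices. -/
theorem foldl_update_block {ι κ α : Type} [DecidableEq ι] [DecidableEq κ] (g : ι → κ → α)
    (l : List ι) (l' : List κ) (T : Table ι κ α) (i : ι) (j : κ) :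
    l.foldl (fun T i => l'.foldl (fun T j =>
      Function.update T i (Function.update (T i) j (g i j))) T) T i j =
      if i ∈ l ∧ j ∈ l' then g i j else T i j := by
  simp only [foldl_update_row]
  induction l using List.reverseRecOn with
  | nil => simp
  | append_singleton l a ih =>
    rw [List.foldl_append, List.foldl_cons, List.foldl_nil]
    by_cases h : i = a
    · subst h
      rw [Function.update_self, ih]
      by_cases hj : j ∈ l' <;> simp [hj]
    · rw [Function.update_of_ne h, ih]
      simp [h]

theorem foldl_nodes (i : Fin n) (l : List (Fin n)) (l₀ : List (Vertex n)) :
    (∀ x, x ∈ l.foldl (fun acc v => if v = i then acc else Vertex.node v :: acc) l₀ ↔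
      x ∈ l₀ ∨ ∃ v ∈ l, v ≠ i ∧ x = .node v) ∧
    (l.foldl (fun acc v => if v = i then acc else Vertex.node v :: acc) l₀).length ≤
      l₀.length + l.length := by
  induction l generalizing l₀ with
  | nil => simp
  | cons a l ih =>
    rw [List.foldl_cons]
    by_cases h : a = i
    · rw [if_pos h]
      refine ⟨fun x => ?_, (ih l₀).2.trans (by simp)⟩
      rw [(ih l₀).1 x]
      simp [h]
    · rw [if_neg h]
      refine ⟨fun x => ?_, (ih _).2.trans (by simp; omega)⟩
      rw [(ih _).1 x]
      simp [h, or_assoc, or_left_comm]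

theorem buildDigraph_val (R : Table (Fin n) (Fin n) EReal) (i : Fin n) :
    (buildDigraph R i).val.verts = .source :: .target :: (List.finRange n).foldl
      (fun acc v => if v = i then acc else Vertex.node v :: acc) [] ∧
    ∀ x y, (buildDigraph R i).val.weight x y =
      if x ∈ (buildDigraph R i).val.verts ∧ y ∈ (buildDigraph R i).val.verts then
        (edgeWeight R i x y).val else none := by
  have hverts : (buildDigraph R i).val.verts = .source :: .target :: (List.finRange n).foldl
      (fun acc v => if v = i then acc else Vertex.node v :: acc) [] := by
    simp only [buildDigraph, Counted.val_bind, val_op, val_forEach, Counted.val_pure]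
    congr 3
    ext1 acc
    ext1 v
    by_cases h : v = i <;> simp [h]
  refine ⟨hverts, fun x y => ?_⟩
  rw [← foldl_update_block (fun x y => (edgeWeight R i x y).val) _ _ (fun _ _ => none)]
  simp only [buildDigraph, Counted.val_bind, val_op, val_forEach, Counted.val_pure, val_write]

theorem mem_verts_buildDigraph (R : Table (Fin n) (Fin n) EReal) (i : Fin n) (x : Vertex n) :
    x ∈ (buildDigraph R i).val.verts ↔ x ≠ .node i := by
  rw [(buildDigraph_val R i).1, List.mem_cons, List.mem_cons, (foldl_nodes i _ []).1]
  cases x <;> simp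

theorem length_verts_buildDigraph_le (R : Table (Fin n) (Fin n) EReal) (i : Fin n) :
    (buildDigraph R i).val.verts.length ≤ n + 2 := by
  rw [(buildDigraph_val R i).1, List.length_cons, List.length_cons]
  have := (foldl_nodes i (List.finRange n) []).2
  simp only [List.length_finRange, List.length_nil] at this
  omega

theorem ops_buildDigraph_le (R : Table (Fin n) (Fin n) EReal) (i : Fin n) :
    (buildDigraph R i).ops ≤ n * 3 + 2 + (n + 2) * ((n + 2) * 4 + 1) := by
  have hlen := length_verts_buildDigraph_le R i
  simp only [buildDigraph, Counted.ops_bind, Counted.val_bind, val_op, ops_op, Counted.ops_pure,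
    Counted.val_pure] at hlen ⊢
  generalize hV : (_ :: _ :: _ : List (Vertex n)) = verts at hlen ⊢
  have h1 : (forEach (List.finRange n) (fun v (l : List (Vertex n)) => do
      let same ← op (decide (v = i))
      if same then pure l else op (Vertex.node v :: l)) []).ops ≤ n * 3 := by
    refine (ops_forEach_le _ _ _ 2 fun v _ l => ?_).trans_eq (by simp)
    by_cases h : v = i <;> simp [h]
  have h2 : (forEach verts (fun x T => forEach verts (fun y T => do
      let e ← edgeWeight R i x y
      write T x y e) T) (fun _ _ => none)).ops ≤ verts.length * (verts.length * 4 + 1) := by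
    refine ops_forEach_le _ _ _ _ fun x _ T => ops_forEach_le _ _ _ 3 fun y _ T => ?_
    have := ops_edgeWeight_le R i x y
    simp only [Counted.ops_bind, ops_write]
    omega
  have h3 : verts.length * (verts.length * 4 + 1) ≤ (n + 2) * ((n + 2) * 4 + 1) := by gcongr
  omega

theorem mem_leaderSet (i : Fin n) (P : List (Vertex n)) (v : Fin n) :
    v ∈ (leaderSet i P).val ↔ v = i ∨ Vertex.node v ∈ P := by
  simp only [leaderSet, Counted.val_bind, val_op, val_forEach]
  induction P using List.reverseRecOn with
  | nil => simp
  | append_singleton P x ih =>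
    rw [List.foldl_append, List.foldl_cons, List.foldl_nil]
    cases x with
    | source => simpa using ih
    | target => simpa using ih
    | node w =>
      rw [val_op, Finset.mem_insert, ih]
      simp only [List.mem_append, List.mem_singleton, Vertex.node.injEq]
      tauto

theorem ops_leaderSet_le (i : Fin n) (P : List (Vertex n)) :
    (leaderSet i P).ops ≤ n + 1 + P.length * 2 := by
  simp only [leaderSet, Counted.ops_bind, val_op, ops_op]
  rw [← add_assoc]
  exact Nat.add_le_add_left (ops_forEach_le P _ _ 1 fun x _ S => by cases x <;> simp) _

/-! ## Closed walks from leader sets -/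

/-- The number of clockwise steps from `i` to `x`. -/
def offset (i x : Fin n) : ℕ := if (i : ℕ) ≤ x then (x : ℕ) - i else x + n - i

theorem offset_self (i : Fin n) : offset i i = 0 := by simp [offset]

theorem offset_injective (i : Fin n) : Function.Injective (offset i) := by
  intro x y hxy
  have := x.isLt
  have := y.isLt
  have := i.isLt
  simp only [offset] at hxy
  ext
  split_ifs at hxy <;> omega

/-- The hypothesis says that the segment from `u` to `v` does not pass `i` in its interior. On such
a segment clockwise order is the order of offsets. -/
theorem StrictlyBetween.offset_lt {i u v f : Fin n} (hb : StrictlyBetween u v f)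
    (h : v = i ∨ offset i u < offset i v) :
    offset i u < offset i f ∧ (v = i ∨ offset i f < offset i v) := by
  have := u.isLt
  have := v.isLt
  have := f.isLt
  have := i.isLt
  simp only [StrictlyBetween, offset, Fin.lt_def, Fin.le_def, Fin.ext_iff] at *
  split_ifs at * <;> omega

/-- The leaders, enumerated clockwise from `i`. -/
theorem exists_clockwise_enumeration {k : ℕ} (hk : 1 ≤ k) {S : Finset (Fin n)} {i : Fin n}
    (hi : i ∈ S) (hS : S.card = k) :
    ∃ p : ℕ → Fin n, p 0 = i ∧ p k = i ∧ (∀ j, 1 ≤ j → j < k → p j ≠ i) ∧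
      (∀ j, j + 1 < k → p j ≠ p (j + 1)) ∧
      ∀ j < k, ∀ f ∈ S, ¬ StrictlyBetween (p j) (p (j + 1)) f := by
  -- Sorting by offset lists the leaders clockwise; `i` has offset `0` and comes first.
  have hcard : (S.image (offset i)).card = k := by rw [Finset.card_image_of_injective _ (offset_injective i), hS]
  let e := (S.image (offset i)).orderEmbOfFin hcard
  have he (j : Fin k) : ∃ x ∈ S, offset i x = e j := 
    Finset.mem_image.1 (Finset.orderEmbOfFin_mem _ hcard j)
  choose q hqS hq using he
  have hsurj : ∀ f ∈ S, ∃ j, q j = f := by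
    intro f hf
    have : offset i f ∈ Set.range e := by
      rw [Finset.range_orderEmbOfFin]
      exact Finset.mem_coe.2 (Finset.mem_image_of_mem _ hf)
    obtain ⟨j, hj⟩ := this
    exact ⟨j, offset_injective i ((hq j).trans hj)⟩
  have hlt {a b : Fin k} : offset i (q a) < offset i (q b) ↔ a < b := by
    rw [hq, hq]
    exact e.lt_iff_lt
  have hq0 : q ⟨0, hk⟩ = i := by
    obtain ⟨j, hj⟩ := hsurj i hi
    have : ¬ (⟨0, hk⟩ : Fin k) < j := by
      rw [← hlt, hj, offset_self]
      omega
    have h0 : j = ⟨0, hk⟩ := by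
      ext
      simpa [Fin.lt_def] using this
    rw [← h0, hj]
  have hinj : Function.Injective q := by
    intro a b hab
    by_contra hne
    rcases lt_or_gt_of_ne hne with h | h
    · have := hlt.2 h
      rw [hab] at this
      exact lt_irrefl _ this
    · have := hlt.2 h
      rw [hab] at this
      exact lt_irrefl _ this
  -- The default value `i` at index `k` closes the walk. For `k = 1` the only step goes from `i` to
  -- itself, which is why distinctness of successive nodes is needed only for `j + 1 < k`.
  refine ⟨fun j => if h : j < k then q ⟨j, h⟩ else i, by simp [show 0 < k from hk, hq0], by simp,
    fun j h1 h2 => ?_, fun j hj => ?_, fun j hj f hf hb => ?_⟩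
  · simp only [h2, dif_pos]
    rw [← hq0]
    exact fun h => by
      have := Fin.ext_iff.1 (hinj h)
      simp only at this
      omega
  · simp only [hj, show j < k by omega, dif_pos]
    exact fun h => by
      have := Fin.ext_iff.1 (hinj h)
      simp only at this
      omega
  · obtain ⟨a, rfl⟩ := hsurj f hf
    have ha := a.isLt
    have h1 := hlt (a := ⟨j, hj⟩) (b := a)
    simp only [hj, dif_pos] at hb
    by_cases hj1 : j + 1 < k
    · have h2 := hlt (a := a) (b := ⟨j + 1, hj1⟩)
      have h3 := (hlt (a := ⟨j, hj⟩) (b := ⟨j + 1, hj1⟩)).2 (by simp [Fin.lt_def])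
      simp only [hj1, dif_pos] at hb
      obtain ⟨h4, h5 | h5⟩ := hb.offset_lt (Or.inr h3)
      · rw [h5, offset_self] at h3
        exact Nat.not_lt_zero _ h3
      · rw [h1] at h4
        rw [h2] at h5
        simp only [Fin.lt_def] at h4 h5
        omega
    · simp only [hj1, dif_neg, not_false_eq_true] at hb
      have h4 := (hb.offset_lt (Or.inl rfl)).1
      rw [h1] at h4
      simp only [Fin.lt_def] at h4
      omega

/-- The width that the Bellman–Ford algorithm finds for the initial leader `i` is at least the
convergence rate of any leader set that contains `i`. -/
theorem convergenceRate_le_width (hn : 3 ≤ n) (c : ℕ) (W : Fin n → Fin n → ℝ)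
    (hW : ∀ i j : Fin n, (SimpleGraph.cycleGraph n).Adj i j → W i j = W j i)
    {k : ℕ} (hk : 1 ≤ k) (hkn : k ≤ n) {S : Finset (Fin n)} {i : Fin n} (hi : i ∈ S)
    (hS : S.card ≤ k) :
    convergenceRate W S ≤ (bellmanFord (buildDigraph
      (segmentWeights c (computeLaplacian W).val).val i).val .source k).val.1 k .target := by
  -- Row `k` records walks of exactly `k` edges, so the leader set is first padded to `k` nodes; `k
  -- ≤ n` makes this possible, and the rate does not drop.
  obtain ⟨S', hSS', -, hS'⟩ :=
    Finset.exists_subsuperset_card_eq (Finset.subset_univ S) hS (by simpa using hkn)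
  refine (convergenceRate_mono W hW hSS').trans ?_
  obtain ⟨p, hp0, hpk, hpi, hpne, hp⟩ := exists_clockwise_enumeration hk (hSS' hi) hS'
  let w (j : ℕ) : Vertex n := if j = 0 then .source else if j < k then .node (p j) else .target
  have hverts : ∀ j ≤ k, w j ∈ (buildDigraph
      (segmentWeights c (computeLaplacian W).val).val i).val.verts := by
    intro j hj
    rw [mem_verts_buildDigraph]
    simp only [w]
    split
    · simp
    · split
      · simpa using hpi j (by omega) (by assumption)
      · simp
  have hwk : w k = .target := by simp [w, show k ≠ 0 by omega]
  rw [← hwk]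
  refine le_bellmanFord _ _ w le_rfl (by simp [w]) hverts fun j hj =>
    ⟨(segmentWeights c (computeLaplacian W).val).val (p j) (p (j + 1)), ?_, ?_⟩
  · rw [(buildDigraph_val _ i).2, if_pos ⟨hverts j hj.le, hverts (j + 1) hj⟩]
    by_cases h0 : j = 0
    · subst h0
      by_cases h1 : 1 < k
      · simp [w, h1, edgeWeight, hp0]
      · have : k = 1 := by omega
        subst this
        simp [w, edgeWeight, hp0, hpk]
    · by_cases h1 : j + 1 < k
      · simp [w, h0, h1, hj, edgeWeight, hpne j h1]
      · have : j + 1 = k := by omega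
        simp [w, h0, hj, edgeWeight, this, hpk, show k ≠ 0 by omega]
  · refine le_of_forall_real_le fun r hr => ?_
    rw [le_segmentWeights_iff hn c W hW]
    rw [le_convergenceRate_iff W hW] at hr
    exact hr.mono fun f hf hfS => hp j hj f hfS hf

/-- For the initial leader `i`, the leader set of the path that is found has at most `k` nodes, and
the width of the path is at most the convergence rate of this leader set. -/
theorem widestPath_spec (hn : 3 ≤ n) (c : ℕ) (W : Fin n → Fin n → ℝ)
    (hW : ∀ i j : Fin n, (SimpleGraph.cycleGraph n).Adj i j → W i j = W j i)
    {k : ℕ} (hk : 1 ≤ k) (hkn : k ≤ n) (i : Fin n) {P : List (Vertex n)} {a : EReal}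
    (hPa : (widestPath (buildDigraph (segmentWeights c (computeLaplacian W).val).val i).val
      .source .target k).val = (P, a)) :
    (leaderSet i P).val.card ≤ k ∧ a = convergenceRate W (leaderSet i P).val ∧
      (∀ S : Finset (Fin n), i ∈ S → S.card ≤ k → convergenceRate W S ≤ a) := by
  have hlow := fun (S : Finset (Fin n)) => convergenceRate_le_width hn c W hW hk hkn (S := S)
    (i := i)
  rw [widestPath_eq] at hPa
  simp only [Counted.val_bind, val_read, Counted.val_pure, Prod.mk.injEq] at hPa
  have hG := buildDigraph_val (segmentWeights c (computeLaplacian W).val).val i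
  have hmem := mem_verts_buildDigraph (segmentWeights c (computeLaplacian W).val).val i
  generalize (buildDigraph (segmentWeights c (computeLaplacian W).val).val i).val = G at *
  obtain ⟨hlk, hl, -⟩ := shortestLength_spec (bellmanFord G .source k).val.1 .target k
  generalize (shortestLength (bellmanFord G .source k).val.1 .target k).val = l at *
  obtain ⟨hP, ha⟩ := hPa
  rw [← hl, ha] at hlow
  -- The set `{i}` is admissible and its rate is not `⊥`; so the target is reached, and the traced
  -- walk has at least one edge.
  have hbot : ⊥ < a := (bot_lt_minEigenvalue _).trans_le (hlow {i} (by simp) (by simpa using hk))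
  have hl1 : 1 ≤ l := by
    by_contra h
    obtain rfl : l = 0 := by omega
    rw [(bellmanFord_spec G .source k).1 _ ((hmem _).2 (by simp)), if_neg (by simp)] at ha
    exact hbot.ne ha
  obtain ⟨w, hw0, hwl, hw, hwP⟩ := tracePath_spec G .source hlk ((hmem .target).2 (by simp))
    (by rwa [ha])
  rw [hP] at hwP
  rw [ha] at hw
  have hmemS : ∀ j < l, (w j).label i ∈ (leaderSet i P).val := by
    intro j hj
    rw [mem_leaderSet]
    cases hx : w j with
    | source => exact Or.inl rfl
    | target => exact Or.inl rfl
    | node v => exact Or.inr ((hwP _).2 ⟨j, hj.le, hx⟩)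
  -- The target has the same label as the source, so the `l` vertices before it account for all
  -- leaders; this gives at most `l ≤ k` of them.
  have hsub : (leaderSet i P).val ⊆ (Finset.range l).image fun j => (w j).label i := by
    intro v hv
    rw [Finset.mem_image]
    rcases (mem_leaderSet i P v).1 hv with rfl | hv
    · exact ⟨0, Finset.mem_range.2 hl1, by rw [hw0]; rfl⟩
    · obtain ⟨j, hj, hjv⟩ := (hwP _).1 hv
      have : j ≠ l := by
        rintro rfl
        rw [hwl] at hjv
        cases hjv
      exact ⟨j, Finset.mem_range.2 (by omega), by rw [hjv]; rfl⟩
  have hcard : (leaderSet i P).val.card ≤ k :=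
    (Finset.card_le_card hsub).trans (Finset.card_image_le.trans (by simpa using hlk))
  -- The optimality bound, applied to the traced set itself, gives one inequality; the closed walk
  -- gives the other.
  refine ⟨hcard, le_antisymm ?_ (hlow _ ((mem_leaderSet i P i).2 (Or.inl rfl)) hcard), hlow⟩
  refine le_convergenceRate_of_walk hn c W hW hl1 (fun j => (w j).label i) ?_ hmemS fun j hj => ?_
  · simp only [hw0, hwl]
    rfl
  · obtain ⟨y, hy, hle⟩ := hw j hj
    rw [hG.2] at hy
    split at hy
    · rwa [← edgeWeight_label hy]
    · cases hy

/-! ## The leader selection algorithm -/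

/-- The loop over the initial leaders keeps a candidate of largest value. -/
theorem foldl_best {α : Type} (f : Fin n → α) (g : Fin n → EReal) (l : List (Fin n)) :
    (∀ i ∈ l, g i ≤ (l.foldl (fun best i => if best.2 < g i then (some (i, f i), g i) else best)
      ((none : Option (Fin n × α)), ⊥)).2) ∧
    (l.foldl (fun best i => if best.2 < g i then (some (i, f i), g i) else best)
        ((none : Option (Fin n × α)), ⊥) = (none, ⊥) ∨
      ∃ i ∈ l, l.foldl (fun best i => if best.2 < g i then (some (i, f i), g i) else best)
        ((none : Option (Fin n × α)), ⊥) = (some (i, f i), g i)) := by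
  induction l using List.reverseRecOn with
  | nil => simp
  | append_singleton l a ih =>
    rw [List.foldl_append, List.foldl_cons, List.foldl_nil]
    generalize l.foldl _ _ = st at ih ⊢
    obtain ⟨h1, h2⟩ := ih
    split
    case isTrue hlt =>
      refine ⟨fun i hi => ?_, Or.inr ⟨a, by simp, rfl⟩⟩
      rcases List.mem_append.1 hi with hi | hi
      · exact (h1 i hi).trans hlt.le
      · rw [List.mem_singleton.1 hi]
    case isFalse hlt =>
      refine ⟨fun i hi => ?_, h2.imp id fun ⟨i, hi, h⟩ => ⟨i, by simp [hi], h⟩⟩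
      rcases List.mem_append.1 hi with hi | hi
      · exact h1 i hi
      · rw [List.mem_singleton.1 hi]
        exact not_lt.1 hlt

end Digraph

section Selection

variable {n : ℕ}

theorem selectLeaders_spec (hn : 3 ≤ n) (c : ℕ) (W : Fin n → Fin n → ℝ)
    (hW : ∀ i j : Fin n, (SimpleGraph.cycleGraph n).Adj i j → W i j = W j i)
    {k : ℕ} (hk : 1 ≤ k) (hkn : k ≤ n) :
    (selectLeaders c W k).val.1.card ≤ k ∧
    (∀ S : Finset (Fin n), S.card ≤ k →
      convergenceRate W S ≤ convergenceRate W (selectLeaders c W k).val.1) ∧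
    (selectLeaders c W k).val.2 = convergenceRate W (selectLeaders c W k).val.1 := by
  let path (i : Fin n) := (widestPath (buildDigraph
    (segmentWeights c (computeLaplacian W).val).val i).val .source .target k).val
  have hpath (i : Fin n) := widestPath_spec hn c W hW hk hkn i (P := (path i).1) (a := (path i).2)
    rfl
  have hloop : (selectLeaders c W k).val =
      ((match ((List.finRange n).foldl (fun best i =>
          if best.2 < (path i).2 then (some (i, (path i).1), (path i).2) else best)
          ((none : Option (Fin n × List (Vertex n))), ⊥)) with
        | (none, b) => pure (∅, b)
        | (some iP, b) => do
          let S ← leaderSet iP.1 iP.2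
          pure (S, b)) : Counted (Finset (Fin n) × EReal)).val := by
    have hfold : (fun (best : Option (Fin n × List (Vertex n)) × EReal) i =>
        if best.2 < (path i).2 then (some (i, (path i).1), (path i).2) else best) =
        fun best i => (do
          let G ← buildDigraph (segmentWeights c (computeLaplacian W).val).val i
          let Pw ← widestPath G Vertex.source Vertex.target k
          let better ← op (decide (best.2 < Pw.2))
          if better then pure (some (i, Pw.1), Pw.2) else pure best : Counted _).val := by
      ext1 best
      ext1 i
      simp only [Counted.val_bind, val_op, path]
      by_cases h : best.2 < (path i).2 <;> simp only [path] at h <;> simp [h]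
    rw [hfold]
    simp only [selectLeaders, Counted.val_bind, val_forEach]
    generalize List.foldl _ _ _ = st
    rcases st with ⟨_ | _, _⟩ <;> rfl
  obtain ⟨hbest, hcand⟩ := foldl_best (fun i => (path i).1) (fun i => (path i).2) (List.finRange n)
  have hrate {i : Fin n} {S : Finset (Fin n)} (hi : i ∈ S) (hS : S.card ≤ k) :=
    ((hpath i).2.2 S hi hS).trans (hbest i (List.mem_finRange i))
  -- An arbitrary node: its singleton shows that some candidate beats `⊥`, and it also dominates the
  -- empty leader set, which contains no initial leader.
  let z : Fin n := ⟨0, by omega⟩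
  have hz := hrate (Finset.mem_singleton_self z) (by simpa using hk)
  rcases hcand with h | ⟨i, -, h⟩
  · rw [h] at hz
    exact absurd hz ((bot_lt_minEigenvalue _).not_ge)
  · rw [h] at hloop hrate hz
    simp only [Counted.val_bind, Counted.val_pure] at hloop
    rw [hloop]
    obtain ⟨h1, h2, -⟩ := hpath i
    refine ⟨h1, fun S hS => ?_, h2⟩
    dsimp only at hrate hz ⊢
    rw [← h2]
    rcases S.eq_empty_or_nonempty with rfl | ⟨j, hj⟩
    · exact (convergenceRate_mono W hW (Finset.empty_subset {z})).trans hz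
    · exact hrate hj hS

/-! ## The number of operations -/

theorem ops_computeLaplacian_le (W : Fin n → Fin n → ℝ) :
    (computeLaplacian W).ops ≤ n * (n * 2 + 11) := by
  refine (ops_forEach_le _ _ _ (n * 2 + 10) fun i _ L => ?_).trans_eq (by simp)
  have := ops_forEach_le (List.finRange n) (fun j (L : Table (Fin n) (Fin n) ℝ) => write L i j 0)
    L 1 fun j _ L => by simp
  rw [List.length_finRange] at this
  simp only [Counted.ops_bind, ops_op, ops_read, ops_write]
  exact Nat.add_le_add_right this 10

theorem ops_segmentWeight_le (c : ℕ) (L : Table (Fin n) (Fin n) ℝ) (u v : Fin n) :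
    (segmentWeight c L u v).ops ≤ 4 + n * 6 + c * n := by
  have hm : segmentLength u v < n := Nat.mod_lt _ u.pos
  simp only [segmentWeight, Counted.ops_bind, val_op, ops_op]
  change 1 + (1 + (1 + (1 + ((forEach (List.range (segmentLength u v)) _ _).ops +
    c * (segmentLength u v + 1))))) ≤ _
  have h1 := ops_forEach_le (List.range (segmentLength u v))
    (fun j (st : Fin n × Table ℕ Bool ℝ) => do
      let q ← op (next st.1)
      let x ← read L st.1 st.1
      let y ← read L st.1 q
      let T ← write st.2 j false x
      let T ← write T j true y
      pure (q, T)) (next u, fun _ _ => 0) 5 fun j _ st => by simp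
  rw [List.length_range] at h1
  have h2 : c * (segmentLength u v + 1) ≤ c * n := Nat.mul_le_mul_left _ hm
  refine (Nat.add_le_add_left (Nat.add_le_add_left (Nat.add_le_add_left (Nat.add_le_add_left
    (add_le_add h1 h2) _) _) _) _).trans ?_
  omega

theorem ops_segmentWeights_le (c : ℕ) (L : Table (Fin n) (Fin n) ℝ) :
    (segmentWeights c L).ops ≤ n * (n * (6 + n * 6 + c * n) + 1) := by
  refine (ops_forEach_le _ _ _ (n * (6 + n * 6 + c * n)) fun u _ R => ?_).trans_eq (by simp)
  refine (ops_forEach_le _ _ _ (5 + n * 6 + c * n) fun v _ R => ?_).trans_eq ?_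
  · have := ops_segmentWeight_le c L u v
    simp only [Counted.ops_bind, ops_write]
    omega
  · rw [List.length_finRange]
    ring

theorem ops_candidate_le (R : Table (Fin n) (Fin n) EReal) (k : ℕ) (i : Fin n)
    (best : Option (Fin n × List (Vertex n)) × EReal) :
    (do
      let G ← buildDigraph R i
      let Pw ← widestPath G Vertex.source Vertex.target k
      let better ← op (decide (best.2 < Pw.2))
      if better then pure (some (i, Pw.1), Pw.2) else pure best : Counted _).ops ≤
    n * 3 + (n + 2) * ((n + 2) * 4 + 1) + 2 * ((k + 1) * ((n + 2) * 2 + 1)) +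
      k * ((n + 2) * ((n + 2) * 5 + 3) + 1) + 6 * k + 7 := by
  have h1 := ops_buildDigraph_le R i
  have h2 := ops_widestPath_le (buildDigraph R i).val .source .target k
  have h3 := length_verts_buildDigraph_le R i
  have h4 : (widestPath (buildDigraph R i).val .source .target k).ops ≤
      2 * ((k + 1) * ((n + 2) * 2 + 1)) + k * ((n + 2) * ((n + 2) * 5 + 3) + 1) + 6 * k + 4 :=
    h2.trans (by gcongr)
  simp only [Counted.ops_bind, ops_op]
  have h5 (b : Bool) (x y : Option (Fin n × List (Vertex n)) × EReal) :
      (if b then pure x else pure y : Counted _).ops = 0 := by cases b <;> rfl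
  rw [h5]
  omega

theorem length_widestPath_le {V : Type} [DecidableEq V] (G : WeightedDigraph V) (s t : V)
    (H : ℕ) : (widestPath G s t H).val.1.length ≤ H + 1 := by
  rw [widestPath_eq]
  simp only [Counted.val_bind, Counted.val_pure]
  exact (length_tracePath_le _ _ _).trans
    (Nat.add_le_add_right (shortestLength_spec (bellmanFord G s H).val.1 t H).1 1)

theorem ops_selectLeaders_le (c : ℕ) (W : Fin n → Fin n → ℝ) (k : ℕ) :
    (selectLeaders c W k).ops ≤ n * (n * 2 + 11) + n * (n * (6 + n * 6 + c * n) + 1) +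
      n * (n * 3 + (n + 2) * ((n + 2) * 4 + 1) + 2 * ((k + 1) * ((n + 2) * 2 + 1)) +
      k * ((n + 2) * ((n + 2) * 5 + 3) + 1) + 6 * k + 8) + (n + 1 + (k + 1) * 2) := by
  have h1 := ops_computeLaplacian_le W
  have h2 := ops_segmentWeights_le c (computeLaplacian W).val
  simp only [selectLeaders, Counted.ops_bind]
  set R := (segmentWeights c (computeLaplacian W).val).val
  set body := fun (i : Fin n) (best : Option (Fin n × List (Vertex n)) × EReal) => (do
      let G ← buildDigraph R i
      let Pw ← widestPath G Vertex.source Vertex.target k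
      let better ← op (decide (best.2 < Pw.2))
      if better then pure (some (i, Pw.1), Pw.2) else pure best : Counted _) with hbody
  have h3 := ops_forEach_le (List.finRange n) body (none, ⊥) _
    fun i _ best => ops_candidate_le R k i best
  rw [List.length_finRange] at h3
  -- The cost of building the leader set depends on the length of the retained path, so a length
  -- bound is carried through the loop.
  have h4 : ∀ i P, (forEach (List.finRange n) body (none, ⊥)).val.1 = some (i, P) →
      P.length ≤ k + 1 := by
    rw [val_forEach]
    generalize List.finRange n = l
    induction l using List.reverseRecOn with
    | nil => simp
    | append_singleton l a ih =>
      rw [List.foldl_append, List.foldl_cons, List.foldl_nil]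
      generalize List.foldl _ _ l = st at ih ⊢
      intro i P h
      simp only [hbody, Counted.val_bind, val_op] at h
      by_cases hlt : st.2 < (widestPath (buildDigraph R a).val .source .target k).val.2
      · simp only [hlt, decide_true, if_true, Counted.val_pure, Option.some.injEq,
          Prod.mk.injEq] at h
        rw [← h.2]
        exact length_widestPath_le _ _ _ _
      · simp only [hlt, decide_false, Bool.false_eq_true, if_false, Counted.val_pure] at h
        exact ih i P h
  generalize forEach (List.finRange n) body (none, ⊥) = st at h3 h4 ⊢
  refine (add_le_add h1 (add_le_add h2 (add_le_add h3
    (c := _) (d := n + 1 + (k + 1) * 2) ?_))).trans_eq (by ring)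
  rcases hst : st.val.1 with _ | ⟨i, P⟩
  · exact Nat.zero_le _
  · have h5 := ops_leaderSet_le i P
    have h6 := h4 i P hst
    simp only [Counted.ops_bind, Counted.ops_pure]
    omega

/-- After the shifts `n ↦ n + 1` and `k ↦ k + 1` the difference of the two sides is a polynomial
with nonnegative coefficients. The constant `300` is a generous choice that ensures this. -/
theorem selectLeaders_ops_polynomial_le (c : ℕ) {n k : ℕ} (hn : 1 ≤ n) (hk : 1 ≤ k) :
    n * (n * 2 + 11) + n * (n * (6 + n * 6 + c * n) + 1) +
      n * (n * 3 + (n + 2) * ((n + 2) * 4 + 1) + 2 * ((k + 1) * ((n + 2) * 2 + 1)) +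
      k * ((n + 2) * ((n + 2) * 5 + 3) + 1) + 6 * k + 8) + (n + 1 + (k + 1) * 2) ≤
    (300 + c) * (k * n ^ 3) := by
  obtain ⟨n, rfl⟩ := Nat.exists_eq_add_of_le' hn
  obtain ⟨k, rfl⟩ := Nat.exists_eq_add_of_le' hk
  rw [← Nat.cast_le (α := ℤ), ← sub_nonneg]
  push_cast
  ring_nf
  positivity

end Selection

end RingLeader

theorem theorem4 (c : ℕ) :
    ∃ C : ℕ, ∀ (n k : ℕ) (W : Fin n → Fin n → ℝ),
      3 ≤ n → 1 ≤ k → k ≤ n →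
      (∀ i j : Fin n, (SimpleGraph.cycleGraph n).Adj i j → 0 < W i j) →
      (∀ i j : Fin n, (SimpleGraph.cycleGraph n).Adj i j → W i j = W j i) →
      (RingLeader.selectLeaders c W k).val.1.card ≤ k ∧
      (∀ S : Finset (Fin n), S.card ≤ k →
        RingLeader.convergenceRate W S ≤
          RingLeader.convergenceRate W (RingLeader.selectLeaders c W k).val.1) ∧
      (RingLeader.selectLeaders c W k).val.2 =
        RingLeader.convergenceRate W (RingLeader.selectLeaders c W k).val.1 ∧
      (RingLeader.selectLeaders c W k).ops ≤ C * (k * n ^ 3) := by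
  refine ⟨300 + c, fun n k W hn hk hkn _ hW => ?_⟩
  obtain ⟨h1, h2, h3⟩ := RingLeader.selectLeaders_spec hn c W hW hk hkn
  exact ⟨h1, h2, h3, (RingLeader.ops_selectLeaders_le c W k).trans
    (RingLeader.selectLeaders_ops_polynomial_le c (by omega) hk)⟩
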